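/- Let $K$ be a nonarchimedean local field (a finite extension of $\mathbb{Q}_p$ or $\mathbb{F}_p((t))$) with integer ring $\mathcal{O}_K$ and residue characteristic $p\neq 2$. Let $n\ge 0$ and let $G\subset \mathrm{GL}_n(\mathcal{O}_K)$ be the group of signed permutation matrices, that is, of the matrices having in every row and every column exactly one nonzero entry, this entry being $1$ or $-1$. Let $\iota:G\hookrightarrow \mathrm{GL}_n(\mathcal{O}_K)$ be the inclusion and $\tau:=\iota\oplus\iota:G\to\mathrm{GL}_{2n}(\mathcal{O}_K)$. For a finite group $\Gamma$, a representation $\sigma:\Gamma\to\mathrm{GL}_d(\mathcal{O}_K)$ and a continuous homomorphism $\rho:\mathrm{Gal}(K^{\mathrm{sep}}/K)\to\Gamma$, define $\mathbf{a}_\sigma(\rho)$ and $\mathbf{v}_\sigma(\rho)$ as follows. (1) Let $H$ be the image of $\rho$, let $L/K$ be the corresponding Galois extension with group $H$, and let $H\supset H_0\supset H_1\supset\cdots$ be the ramification groups in the lower numbering. The Artin conductor is $$\mathbf{a}_\sigma(\rho):=\sum_{i=0}^{\infty}\frac{1}{(H_0:H_i)}\,\mathrm{codim}\,(K^d)^{H_i}.$$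 (2) Let $M$ be the $K$-algebra, with its $\Gamma$-action, of the étale $\Gamma$-torsor $\mathrm{Spec}\,M\to\mathrm{Spec}\,K$ corresponding to $\rho$, and let $\mathcal{O}_M$ be its integer ring. Let $\Xi\subset\mathcal{O}_M^{\oplus d}=\mathrm{Hom}_{\mathcal{O}_K}(\mathcal{O}_K^{\oplus d},\mathcal{O}_M)$ be the $\mathcal{O}_K$-submodule of $\Gamma$-equivariant maps, where $\Gamma$ acts on $\mathcal{O}_K^{\oplus d}$ through $\sigma$. Put $$\mathbf{v}_\sigma(\rho):=\frac{1}{\sharp\Gamma}\,\mathrm{length}_{\mathcal{O}_K}\!\left(\frac{\mathcal{O}_M^{\oplus d}}{\mathcal{O}_M\cdot\Xi}\right).$$ Then for every continuous homomorphism $\rho:\mathrm{Gal}(K^{\mathrm{sep}}/K)\to G$ the numbers $\mathbf{a}_\iota(\rho)$ and $\mathbf{v}_\tau(\rho)$ are finite and $$\mathbf{a}_\iota(\rho)=\mathbf{v}_\tau(\rho).$$ -/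

import Mathlib

open ValuativeRel
open scoped ENNReal Topology

noncomputable section

/-! ### Representations over a commutative ring -/

/-- The direct sum of two representations `Γ → GL(R)`, as block diagonal matrices. -/
def directSumRep {Γ R m m' : Type*} [Group Γ] [CommRing R]
    [Fintype m] [DecidableEq m] [Fintype m'] [DecidableEq m']
    (τ : Γ →* GL m R) (τ' : Γ →* GL m' R) : Γ →* GL (m ⊕ m') R :=
  MonoidHom.toHomUnits
    { toFun := fun γ => Matrix.fromBlocks (τ γ : Matrix m m R) 0 0 (τ' γ : Matrix m' m' R)
      map_one' := by simp
      map_mul' := fun a b => by simp [Matrix.fromBlocks_multiply] }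

/-! ### The group of signed permutation matrices -/

/-- Every row and every column of the matrix contains one and only one nonzero entry, and this
entry is `1` or `-1`. -/
def IsSignedPermMatrix {R : Type*} [CommRing R] {n : ℕ} (A : Matrix (Fin n) (Fin n) R) : Prop :=
  (∀ i, ∃! j, A i j ≠ 0) ∧ (∀ j, ∃! i, A i j ≠ 0) ∧ ∀ i j, A i j ≠ 0 → A i j = 1 ∨ A i j = -1

theorem IsSignedPermMatrix.one {R : Type*} [CommRing R] [Nontrivial R] {n : ℕ} :
    IsSignedPermMatrix (1 : Matrix (Fin n) (Fin n) R) := by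
  refine ⟨fun i => ⟨i, by simp, fun j hj => ?_⟩, fun i => ⟨i, by simp, fun j hj => ?_⟩,
    fun i j hij => ?_⟩
  · by_contra h
    exact hj (Matrix.one_apply_ne (Ne.symm h))
  · by_contra h
    exact hj (Matrix.one_apply_ne h)
  · by_cases h : i = j
    · subst h; simp
    · exact absurd (Matrix.one_apply_ne h) hij

theorem IsSignedPermMatrix.transpose {R : Type*} [CommRing R] {n : ℕ}
    {A : Matrix (Fin n) (Fin n) R} (hA : IsSignedPermMatrix A) :
    IsSignedPermMatrix A.transpose :=
  ⟨hA.2.1, hA.1, fun i j h => hA.2.2 j i h⟩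

theorem IsSignedPermMatrix.mul_apply {R : Type*} [CommRing R] {n : ℕ}
    {A : Matrix (Fin n) (Fin n) R} (B : Matrix (Fin n) (Fin n) R)
    {i j : Fin n} (h : ∀ j', A i j' ≠ 0 → j' = j) (k : Fin n) :
    (A * B) i k = A i j * B j k := by
  rw [Matrix.mul_apply]
  refine Finset.sum_eq_single j (fun b _ hb => ?_) (by simp)
  have : A i b = 0 := by
    by_contra h0
    exact hb (h b h0)
  rw [this, zero_mul]

theorem IsSignedPermMatrix.mul {R : Type*} [CommRing R] {n : ℕ}
    {A B : Matrix (Fin n) (Fin n) R} (hA : IsSignedPermMatrix A) (hB : IsSignedPermMatrix B) :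
    IsSignedPermMatrix (A * B) := by
  have key : ∀ {A B : Matrix (Fin n) (Fin n) R}, IsSignedPermMatrix A → IsSignedPermMatrix B →
      ∀ i, ∃! k, (A * B) i k ≠ 0 := by
    intro A B hA hB i
    obtain ⟨j, hj, hju⟩ := hA.1 i
    obtain ⟨k, hk, hku⟩ := hB.1 j
    refine ⟨k, ?_, fun k' hk' => hku k' fun h0 => hk' ?_⟩
    · change (A * B) i k ≠ 0
      rw [IsSignedPermMatrix.mul_apply B hju]
      rcases hA.2.2 i j hj with h | h <;> rw [h] <;> simpa using hk
    · rw [IsSignedPermMatrix.mul_apply B hju, h0, mul_zero]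
  refine ⟨key hA hB, fun j => ?_, fun i k hik => ?_⟩
  · simpa only [← Matrix.transpose_mul, Matrix.transpose_apply] using
      key hB.transpose hA.transpose j
  · obtain ⟨j, hj, hju⟩ := hA.1 i
    rw [IsSignedPermMatrix.mul_apply B hju] at hik ⊢
    have hB0 : B j k ≠ 0 := fun h => hik (by rw [h, mul_zero])
    rcases hA.2.2 i j hj with h | h <;> rcases hB.2.2 j k hB0 with h' | h' <;> rw [h, h'] <;> simp

theorem IsSignedPermMatrix.mul_transpose {R : Type*} [CommRing R] {n : ℕ}
    {A : Matrix (Fin n) (Fin n) R} (hA : IsSignedPermMatrix A) :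
    A * A.transpose = 1 := by
  ext i k
  obtain ⟨j, hj, hju⟩ := hA.1 i
  rw [IsSignedPermMatrix.mul_apply A.transpose hju, Matrix.transpose_apply]
  by_cases hik : i = k
  · subst hik
    rcases hA.2.2 i j hj with h | h <;> rw [h] <;> simp
  · have : A k j = 0 := by
      by_contra h0
      exact hik ((hA.2.1 j).unique hj h0)
    rw [this, mul_zero, Matrix.one_apply_ne hik]

/-- The group of signed permutation matrices in `GL_n(R)`. -/
def signedPermGroup (n : ℕ) (R : Type*) [CommRing R] [Nontrivial R] : Subgroup (GL (Fin n) R) where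
  carrier := {g | IsSignedPermMatrix (g : Matrix (Fin n) (Fin n) R)}
  one_mem' := IsSignedPermMatrix.one
  mul_mem' := fun ha hb => IsSignedPermMatrix.mul ha hb
  inv_mem' := fun {g} hg => by
    have h1 : ((g⁻¹ : GL (Fin n) R) : Matrix (Fin n) (Fin n) R) =
        (g : Matrix (Fin n) (Fin n) R).transpose := by
      rw [← Matrix.mul_one ((g⁻¹ : GL (Fin n) R) : Matrix (Fin n) (Fin n) R),
        ← IsSignedPermMatrix.mul_transpose hg, ← Matrix.mul_assoc, Units.inv_mul, Matrix.one_mul]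
    change IsSignedPermMatrix ((g⁻¹ : GL (Fin n) R) : Matrix (Fin n) (Fin n) R)
    rw [h1]
    exact IsSignedPermMatrix.transpose hg

instance signedPermGroup.instFinite (n : ℕ) (R : Type*) [CommRing R] [Nontrivial R] :
    Finite (signedPermGroup n R) := by
  have hfin : ({0, 1, -1} : Set R).Finite := by simp
  have : Finite ({0, 1, -1} : Set R) := hfin.to_subtype
  have hmem : ∀ (g : signedPermGroup n R) (i j : Fin n),
      (g : GL (Fin n) R) i j ∈ ({0, 1, -1} : Set R) := fun g i j => by
    by_cases h : (g : GL (Fin n) R) i j = 0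
    · exact Or.inl h
    · exact Or.inr (g.2.2.2 i j h)
  refine Finite.of_injective
    (fun g i j => (⟨(g : GL (Fin n) R) i j, hmem g i j⟩ : ({0, 1, -1} : Set R))) ?_
  intro g g' h
  ext i j
  exact congrArg Subtype.val (congrFun (congrFun h i) j)

/-! ### Tuning submodules -/

section Tuning

variable {O A Γ m : Type*} [CommRing O] [CommRing A] [Algebra O A] [Group Γ]
  [Fintype m] [DecidableEq m]

/-- For a representation `τ : Γ → GL_d(O)` and an action of `Γ` on an `O`-algebra `A`, the tuning
submodule `Ξ ⊆ A^d = Hom_O(O^d, A)`: the `Γ`-equivariant maps. The vector `φ` stands for the map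
with `e_i ↦ φ i`, and equivariance is tested on the basis, where
`τ(γ) e_j = ∑ i, τ(γ)_{ij} e_i`. -/
def tuningSubmodule (act : Γ → A →ₐ[O] A) (τ : Γ →* GL m O) : Submodule O (m → A) where
  carrier := {φ | ∀ (γ : Γ) (j : m), ∑ i, (τ γ : Matrix m m O) i j • φ i = act γ (φ j)}
  add_mem' := fun ha hb γ j => by
    simp only [Pi.add_apply, smul_add, Finset.sum_add_distrib, ha γ j, hb γ j, map_add]
  zero_mem' := fun γ j => by simp
  smul_mem' := fun c φ hφ γ j => by
    simp only [Pi.smul_apply, map_smul, ← hφ γ j, Finset.smul_sum]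
    exact Finset.sum_congr rfl fun i _ => smul_comm _ _ _

/-- The length over `O` of `A^d / A Ξ`, where `Ξ` is the tuning submodule. -/
def tuningLength (act : Γ → A →ₐ[O] A) (τ : Γ →* GL m O) : ℕ∞ :=
  Module.length O ((m → A) ⧸ Submodule.span A (tuningSubmodule act τ : Set (m → A)))

end Tuning

/-! ### Galois representations with values in a finite group -/

/-- The set `S_{K,Γ}` of continuous homomorphisms from the absolute Galois group
`Gal(K^sep/K)`, with its Krull topology, to the discrete group `Γ`. -/
structure GaloisHom (K Γ : Type*) [Field K] [Group Γ] where
  hom : Gal(SeparableClosure K/K) →* Γ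
  continuous_hom : @Continuous _ _ inferInstance ⊥ hom

namespace GaloisHom

variable {K Γ : Type*} [Field K] [Group Γ]

/-- The Galois extension `L/K` cut out by `ρ`: the fixed field of `ker ρ`. Its Galois group is
identified with the image `H` of `ρ`. -/
def splittingField (ρ : GaloisHom K Γ) : IntermediateField K (SeparableClosure K) :=
  IntermediateField.fixedField ρ.hom.ker

theorem isClosed_ker (ρ : GaloisHom K Γ) :
    IsClosed (ρ.hom.ker : Set Gal(SeparableClosure K/K)) := by
  let _ : TopologicalSpace Γ := ⊥
  have : DiscreteTopology Γ := ⟨rfl⟩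
  have h : IsClosed (ρ.hom ⁻¹' {1}) := (isClosed_discrete {1}).preimage ρ.continuous_hom
  exact h

instance isGalois_splittingField (ρ : GaloisHom K Γ) : IsGalois K ρ.splittingField := by
  rw [← InfiniteGalois.normal_iff_isGalois]
  have h := InfiniteGalois.fixingSubgroup_fixedField
    (⟨ρ.hom.ker, ρ.isClosed_ker⟩ : ClosedSubgroup Gal(SeparableClosure K/K))
  have h' : ρ.splittingField.fixingSubgroup = ρ.hom.ker := h
  rw [h']
  infer_instance

end GaloisHom

/-! ### Ramification groups and the Artin conductor -/

section LocalField

variable {K : Type*} [Field K] [ValuativeRel K]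

/-- The `i`-th ramification group in the lower numbering of a finite Galois extension `L/K` of a
local field: the `σ` acting trivially on `𝒪_L / 𝔪_L ^ (i + 1)`. Here `𝒪_L` is the integral closure
of `𝒪_K` in `L`; it is a local ring, so that its maximal ideal `𝔪_L` is its Jacobson radical. -/
def lowerRamificationGroup (K L : Type*) [Field K] [ValuativeRel K] [Field L] [Algebra K L]
    (i : ℕ) : Subgroup Gal(L/K) :=
  (Ring.jacobson (integralClosure 𝒪[K] L) ^ (i + 1)).toAddSubgroup.inertia Gal(L/K)

variable {Γ : Type*} [Group Γ]

/-- The `i`-th ramification group `H_i ⊆ H ⊆ Γ` of `ρ`, in the lower numbering, where `H` is the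
image of `ρ`, identified with the Galois group of `L/K`. -/
def GaloisHom.ramificationGroup (ρ : GaloisHom K Γ) (i : ℕ) : Subgroup Γ :=
  ((lowerRamificationGroup K ρ.splittingField i).comap
    (AlgEquiv.restrictNormalHom ρ.splittingField)).map ρ.hom

/-- The subspace of `K^d` fixed by a subgroup `H'` of `Γ` acting through `τ : Γ → GL_d(𝒪_K)`. -/
def fixedVectors {m : Type*} [Fintype m] [DecidableEq m] (τ : Γ →* GL m 𝒪[K])
    (H' : Subgroup Γ) : Submodule K (m → K) where
  carrier := {v | ∀ γ ∈ H',
    ((τ γ : Matrix m m 𝒪[K]).map (algebraMap 𝒪[K] K)).mulVec v = v}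
  add_mem' := fun ha hb γ hγ => by rw [Matrix.mulVec_add, ha γ hγ, hb γ hγ]
  zero_mem' := fun γ _ => Matrix.mulVec_zero _
  smul_mem' := fun c v hv γ hγ => by rw [Matrix.mulVec_smul, hv γ hγ]

/-- The Artin conductor
`a_τ(ρ) = ∑_{i ≥ 0} (H_0 : H_i)⁻¹ codim (K^d)^{H_i}`, with values in `[0, ∞]`. -/
def artinConductor {m : Type*} [Fintype m] [DecidableEq m] [Finite Γ] (τ : Γ →* GL m 𝒪[K])
    (ρ : GaloisHom K Γ) : ℝ≥0∞ :=
  ∑' i : ℕ,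
    (Module.finrank K ((m → K) ⧸ fixedVectors τ (ρ.ramificationGroup i)) : ℝ≥0∞) /
      ((ρ.ramificationGroup i).relIndex (ρ.ramificationGroup 0) : ℝ≥0∞)

/-! ### The étale torsor, the tuning submodule and the function `v` -/

/-- The étale `K`-algebra `M` such that `Spec M → Spec K` is the `Γ`-torsor corresponding to `ρ`:
the `Gal(K^sep/K)`-equivariant maps from `Γ` to `K^sep`, where `Gal(K^sep/K)` acts on `Γ` by left
multiplication through `ρ`. -/
def torsorAlgebra (ρ : GaloisHom K Γ) : Subalgebra K (Γ → SeparableClosure K) where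
  carrier := {f | ∀ (g : Gal(SeparableClosure K/K)) (x : Γ), f (ρ.hom g * x) = g (f x)}
  mul_mem' := fun ha hb g x => by simp [ha g x, hb g x]
  add_mem' := fun ha hb g x => by simp [ha g x, hb g x]
  algebraMap_mem' := fun r g x => by simp

/-- The left action of `γ : Γ` on `M`: `(γ f)(x) = f(xγ)`. -/
def torsorAction (ρ : GaloisHom K Γ) (γ : Γ) : torsorAlgebra ρ →ₐ[K] torsorAlgebra ρ where
  toFun f := ⟨fun x => f.1 (x * γ), fun g x => by
    simpa only [mul_assoc] using f.2 g (x * γ)⟩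
  map_one' := rfl
  map_mul' _ _ := rfl
  map_zero' := rfl
  map_add' _ _ := rfl
  commutes' _ := rfl

/-- The integer ring `𝒪_M` of `M`. -/
abbrev torsorIntegers (ρ : GaloisHom K Γ) : Subalgebra 𝒪[K] (torsorAlgebra ρ) :=
  integralClosure 𝒪[K] (torsorAlgebra ρ)

/-- The action of `γ : Γ` on `𝒪_M`. -/
def torsorIntegersAction (ρ : GaloisHom K Γ) (γ : Γ) :
    torsorIntegers ρ →ₐ[𝒪[K]] torsorIntegers ρ :=
  ((torsorAction ρ γ).restrictScalars 𝒪[K]).mapIntegralClosure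

/-- `v_τ(ρ) = (1 / #Γ) · length (𝒪_M^d / 𝒪_M Ξ)`, the length being taken over `𝒪_K`, with values
in `[0, ∞]`. -/
def vFunction {m : Type*} [Fintype m] [DecidableEq m] [Finite Γ] (τ : Γ →* GL m 𝒪[K])
    (ρ : GaloisHom K Γ) : ℝ≥0∞ :=
  (tuningLength (torsorIntegersAction ρ) τ : ℝ≥0∞) / (Nat.card Γ : ℝ≥0∞)

end LocalField

end

noncomputable section

/-! The factor 2 in `τ = ι ⊕ ι` is the exponent 2 relating a determinant of conjugates to a
discriminant. Let `L/K` be the extension cut out by `ρ`, `D = Gal(L/K)`, `A = 𝒪_L`, with lower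
ramification groups `D_k`.

For a finite `D`-set `Y`, the permutation representation satisfies `∑_k |D_k| codim (K^Y)^{D_k} = 2
length_A (A^Y / A Ξ_Y)`. Indeed `A = 𝒪_K[β]`; put `i(g) = ord (gβ - β)`, so that `g ≠ 1` lies in
`D_k` iff `k + 1 ≤ i(g)`. By Burnside's count the left side is the sum of `i(g)` over the pairs `(g,
y)` with `gy ≠ y`. The right side reduces to orbits `D/H`, where `Ξ` is `A^H` and the length is the
order of a determinant of conjugates of an `𝒪_K`-basis of `A^H`. That determinant is read off from
those of `A/𝒪_K` and `A/A^H`, which are Vandermonde determinants of conjugates of `β`, and it yields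
the same sum (`permLength_formula`, `sum_card_mul_codim_permFixed`).

A signed permutation representation `ι` acts on the vectors `±e_j`, that is on `Fin n × {±1}`. As 2
is a unit, functions on this set split into even ones, the permutation representation on `Fin n`,
and odd ones, which form `ι`. Both sides of the identity are additive, so subtraction gives it for
`ι` (`sum_card_mul_codim_fixedVectors`).

Finally `M` is induced from `L`, so its tuning length is `|Γ|/|D|` times that of `L`
(`tuningLength_mul_card`), and `length_{𝒪_K} = f · length_A`. With `e f = |D|`, `e = |D_0|` and `ℓ`
the length over `A` for `ι`, both the conductor of `ι` and `v` of `ι ⊕ ι` equal `2ℓ/e`. -/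

theorem Matrix.length_quotient_range_mulVecLin {A Y : Type*} [CommRing A] [IsDomain A]
    [IsPrincipalIdealRing A] [Fintype Y] [DecidableEq Y] (P : Matrix Y Y A) (hP : P.det ≠ 0) :
    Module.length A ((Y → A) ⧸ LinearMap.range P.mulVecLin) = Ring.ord A P.det := by
  have hinj : Function.Injective P.mulVecLin := by
    rw [← LinearMap.ker_eq_bot, LinearMap.ker_eq_bot']
    exact fun v hv => Matrix.eq_zero_of_mulVec_eq_zero hP hv
  set N := LinearMap.range P.mulVecLin
  have hrank : Module.finrank A N = Module.finrank A (Y → A) :=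
    LinearMap.finrank_range_of_inj hinj
  let b := Pi.basisFun A Y
  let a := Submodule.smithNormalFormCoeffs b hrank
  let e₁ : (Y → A) ≃ₗ[A] N := LinearEquiv.ofInjective _ hinj
  let bT := Submodule.smithNormalFormTopBasis b hrank
  let bB := Submodule.smithNormalFormBotBasis b hrank
  let e₂ : (Y → A) ≃ₗ[A] N := bT.equiv bB (Equiv.refl _)
  have h₁ : N.subtype ∘ₗ (e₁ : (Y → A) →ₗ[A] N) = P.mulVecLin := LinearMap.ext fun _ => rfl
  have h₂ : N.subtype ∘ₗ (e₂ : (Y → A) →ₗ[A] N) = Matrix.toLin bT bT (Matrix.diagonal a) := by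
    refine bT.ext fun i => ?_
    simp only [LinearMap.comp_apply, LinearEquiv.coe_coe, e₂, Module.Basis.equiv_apply,
      Equiv.refl_apply, Submodule.subtype_apply, Matrix.toLin_self, Matrix.diagonal_apply,
      ite_smul, zero_smul, Finset.sum_ite_eq', Finset.mem_univ, if_true]
    rw [Submodule.smithNormalFormBotBasis_def]
  -- `P` and the diagonal Smith form are the inclusion of the range composed with two isomorphisms
  -- from `Y → A`, so their determinants differ by a unit.
  have hassoc : Associated P.det (∏ i, a i) := by
    have h := LinearMap.associated_det_comp_equiv N.subtype e₁ e₂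
    rwa [h₁, h₂, LinearMap.det_toLin, Matrix.det_diagonal, ← Matrix.toLin'_apply',
      LinearMap.det_toLin'] at h
  have ha : ∀ i, a i ≠ 0 := fun i => Submodule.smithNormalFormCoeffs_ne_zero b hrank i
  rw [(N.quotientEquivPiSpan b hrank).length_eq, Module.length_pi_of_fintype,
    Ring.ord_eq_of_associated hassoc]
  have key : ∀ s : Finset Y, ∑ i ∈ s, Module.length A (A ⧸ Ideal.span {a i}) =
      Ring.ord A (∏ i ∈ s, a i) := by
    classical
    intro s
    induction s using Finset.induction_on with
    | empty => simp
    | insert i s his ih =>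
      rw [Finset.sum_insert his, Finset.prod_insert his, ih, Ring.ord_mul]
      · rfl
      · exact mem_nonZeroDivisors_of_ne_zero (Finset.prod_ne_zero_iff.mpr fun i _ => ha i)
  exact key Finset.univ

theorem Ring.ord_prod {A ι : Type*} [CommRing A] [IsDomain A] (s : Finset ι) (a : ι → A)
    (ha : ∀ i ∈ s, a i ≠ 0) : Ring.ord A (∏ i ∈ s, a i) = ∑ i ∈ s, Ring.ord A (a i) := by
  classical
  induction s using Finset.induction_on with
  | empty => simp
  | insert i s his ih =>
    rw [Finset.sum_insert his, Finset.prod_insert his, Ring.ord_mul,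
      ih fun j hj => ha j (Finset.mem_insert_of_mem hj)]
    exact mem_nonZeroDivisors_of_ne_zero
      (Finset.prod_ne_zero_iff.mpr fun j hj => ha j (Finset.mem_insert_of_mem hj))

/-! ### Power bases of monogenic Galois extensions of rings -/

section GaloisBasis

variable {G B A : Type*} [Group G] [CommRing B] [CommRing A]
  [Algebra B A] [MulSemiringAction G A] [IsGaloisGroup G B A]

theorem IsGaloisGroup.smul_injective_of_adjoin_eq_top (B : Type*) [CommRing B] [Algebra B A]
    [IsGaloisGroup G B A] {β : A}
    (hβ : Algebra.adjoin B {β} = ⊤) : Function.Injective fun g : G => g • β := by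
  intro g g' h
  have hf : FaithfulSMul G A := IsGaloisGroup.faithful B
  refine hf.eq_of_smul_eq_smul fun a => ?_
  have h2 : MulSemiringAction.toAlgHom B A g = MulSemiringAction.toAlgHom B A g' :=
    AlgHom.ext_of_adjoin_eq_top hβ fun x hx => by
      rw [Set.mem_singleton_iff.mp hx]
      exact h
  exact DFunLike.congr_fun h2 a

/-- The matrix of conjugates of the members of a basis indexed by the group. -/
def conjugateMatrix (G : Type*) {A : Type*} [Monoid G] [CommRing A] [MulSemiringAction G A]
    {ι : Type*} (e : ι → A) : Matrix G ι A :=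
  Matrix.of fun g k => g • e k

theorem IsGaloisGroup.det_vandermonde_ne_zero [Fintype G] [IsDomain A] {β : A}
    (hβ : Algebra.adjoin B {β} = ⊤) (σ : Fin (Fintype.card G) ≃ G) :
    (Matrix.vandermonde fun i => σ i • β).det ≠ 0 := by
  rw [Matrix.det_vandermonde_ne_zero_iff]
  exact (IsGaloisGroup.smul_injective_of_adjoin_eq_top B hβ).comp σ.injective

/-- Applying every `g` to a linear relation gives a system with nonzero Vandermonde determinant,
hence independence. The polynomial `∏ (X - gβ)` descends to `B` and is a monic equation of degree
`|G|` for `β`, hence spanning. -/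
theorem IsGaloisGroup.exists_basis_pow [Fintype G] [IsDomain A] [FaithfulSMul B A] {β : A}
    (hβ : Algebra.adjoin B {β} = ⊤) :
    ∃ b : Module.Basis (Fin (Fintype.card G)) B A, ∀ k, b k = β ^ (k : ℕ) := by
  classical
  have hf : FaithfulSMul G A := IsGaloisGroup.faithful B
  have hc : SMulCommClass G B A := IsGaloisGroup.commutes
  have hli : LinearIndependent B fun k : Fin (Fintype.card G) => β ^ (k : ℕ) := by
    rw [Fintype.linearIndependent_iff]
    intro c hcs
    have hV := IsGaloisGroup.det_vandermonde_ne_zero (G := G) hβ (Fintype.equivFin G).symm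
    have h0 : (fun k => algebraMap B A (c k)) = 0 := by
      refine Matrix.eq_zero_of_mulVec_eq_zero hV (funext fun i => ?_)
      have := congrArg (fun x => (Fintype.equivFin G).symm i • x) hcs
      simp only [smul_zero, Finset.smul_sum] at this
      rw [Pi.zero_apply, ← this]
      simp only [Matrix.mulVec, dotProduct, Matrix.vandermonde_apply]
      refine Finset.sum_congr rfl fun k _ => ?_
      rw [smul_comm, smul_pow', Algebra.smul_def, mul_comm]
    intro k
    exact (map_eq_zero_iff _ (FaithfulSMul.algebraMap_injective B A)).mp (congrFun h0 k)
  have hsp : ⊤ ≤ Submodule.span B (Set.range fun k : Fin (Fintype.card G) => β ^ (k : ℕ)) := by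
    obtain ⟨p, hp, hpd, hpm⟩ := Polynomial.lifts_and_natDegree_eq_and_monic
      (Algebra.IsInvariant.charpoly_mem_lifts B A G β) (MulSemiringAction.monic_charpoly G β)
    have hp0 : Polynomial.aeval β p = 0 := by
      rw [← Polynomial.eval_map_algebraMap, hp, MulSemiringAction.eval_charpoly]
    have hdeg : (MulSemiringAction.charpoly G β).natDegree = Fintype.card G := by
      rw [MulSemiringAction.charpoly_eq, Polynomial.natDegree_finsetProd_X_sub_C_eq_card]
      rfl
    have h := Submodule.span_range_natDegree_eq_adjoin hpm hp0
    rw [hβ, Algebra.top_toSubmodule, hpd, hdeg] at h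
    rw [← h]
    refine Submodule.span_mono ?_
    intro x hx
    simp only [Finset.coe_image, Finset.coe_range, Set.mem_image, Set.mem_Iio] at hx
    obtain ⟨k, hk, rfl⟩ := hx
    exact ⟨⟨k, hk⟩, rfl⟩
  exact ⟨Module.Basis.mk hli hsp, fun k => by simp⟩

end GaloisBasis

/-! ### Order of the Vandermonde determinant of the conjugates -/

section Valuation

variable {A : Type*} [CommRing A] [IsDomain A] [IsDiscreteValuationRing A]

theorem IsDiscreteValuationRing.ord_map_ringEquiv (g : A ≃+* A) (x : A) :
    Ring.ord A (g x) = Ring.ord A x := by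
  rcases eq_or_ne x 0 with rfl | hx
  · simp
  obtain ⟨ϖ, hϖ⟩ := IsDiscreteValuationRing.exists_irreducible A
  have hϖ' : Irreducible (g ϖ) := (MulEquiv.irreducible_iff g).mpr hϖ
  obtain ⟨n, hn⟩ := IsDiscreteValuationRing.associated_pow_irreducible hx hϖ
  have hn' : Associated (g x) (g ϖ ^ n) := by
    rw [← map_pow]; exact hn.map g
  rw [Ring.ord_eq_of_associated hn, Ring.ord_eq_of_associated hn',
    Ring.ord_pow (mem_nonZeroDivisors_of_ne_zero hϖ.ne_zero),
    Ring.ord_pow (mem_nonZeroDivisors_of_ne_zero hϖ'.ne_zero),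
    Ring.ord_of_irreducible hϖ, Ring.ord_of_irreducible hϖ']

theorem IsDiscreteValuationRing.ord_smul {G : Type*} [Group G] [MulSemiringAction G A] (g : G)
    (x : A) : Ring.ord A (g • x) = Ring.ord A x :=
  IsDiscreteValuationRing.ord_map_ringEquiv (MulSemiringAction.toRingEquiv G A g) x

/-- Up to sign, the square of the determinant is the product of `σ j • β - σ i • β` over ordered
pairs. As `ord` is invariant under `G`, translating by `(σ i)⁻¹` makes the contribution of each `i`
the same sum over `g ≠ 1`: the discriminant is the norm of the different. -/
theorem IsGaloisGroup.two_mul_ord_det_vandermonde {G B : Type*} [Group G] [Fintype G]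
    [DecidableEq G] [CommRing B]
    [Algebra B A] [MulSemiringAction G A] [IsGaloisGroup G B A] {β : A}
    (hβ : Algebra.adjoin B {β} = ⊤) (σ : Fin (Fintype.card G) ≃ G) :
    2 * Ring.ord A (Matrix.vandermonde fun i => σ i • β).det =
      Fintype.card G * ∑ g ∈ Finset.univ.erase (1 : G), Ring.ord A (g • β - β) := by
  have hinj := IsGaloisGroup.smul_injective_of_adjoin_eq_top (G := G) B hβ
  have hne : ∀ i j, j ≠ i → σ j • β - σ i • β ≠ 0 := fun i j hij h =>
    hij (σ.injective (hinj (sub_eq_zero.mp h)))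
  have hne' : ∀ i, ∀ j ∈ Finset.Ioi i, σ j • β - σ i • β ≠ 0 := fun i j hj =>
    hne i j (Finset.mem_Ioi.mp hj).ne'
  rw [Matrix.det_vandermonde, Ring.ord_prod _ _ fun i _ => Finset.prod_ne_zero_iff.mpr (hne' i),
    Finset.sum_congr rfl fun i _ => Ring.ord_prod _ _ (hne' i), two_mul, ← Finset.sum_add_distrib]
  have h := Finset.sum_sum_Ioi_add_eq_sum_sum_off_diag
    (fun j i => Ring.ord A (σ j • β - σ i • β))
  have h1 : ∀ i j, Ring.ord A (σ i • β - σ j • β) = Ring.ord A (σ j • β - σ i • β) := fun i j => by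
    rw [← neg_sub, Ring.ord_neg]
  rw [Finset.sum_congr rfl fun i _ => Finset.sum_congr rfl fun j _ =>
    congrArg (Ring.ord A (σ j • β - σ i • β) + ·) (h1 i j)] at h
  simp only [Finset.sum_add_distrib] at h ⊢
  have h2 : ∀ i, ∑ j ∈ {i}ᶜ, Ring.ord A (σ j • β - σ i • β) =
      ∑ g ∈ Finset.univ.erase (1 : G), Ring.ord A (g • β - β) := fun i => by
    refine Finset.sum_bij (fun j _ => (σ i)⁻¹ * σ j) ?_ ?_ ?_ ?_
    · intro j hj
      have : j ≠ i := by simpa using hj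
      simpa [inv_mul_eq_one, eq_comm (a := i)] using this
    · intro j _ j' _ h
      exact σ.injective (mul_left_cancel h)
    · intro g hg
      refine ⟨σ.symm (σ i * g), ?_, by simp⟩
      have : g ≠ 1 := by simpa using hg
      simpa [Equiv.symm_apply_eq] using this
    · intro j _
      rw [mul_smul, ← IsDiscreteValuationRing.ord_smul (σ i) (_ - β), smul_sub, smul_inv_smul]
  rw [h, Finset.sum_congr rfl fun i _ => ?_, Finset.sum_const, Finset.card_univ, Fintype.card_fin,
    nsmul_eq_mul]
  exact h2 i

end Valuation

/-! ### Determinants of conjugates in an arbitrary basis -/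

section ConjugateMatrix

variable {G B A : Type*} [Group G] [Fintype G] [DecidableEq G] [CommRing B] [CommRing A]
  [Algebra B A] [MulSemiringAction G A] [IsGaloisGroup G B A]

/-- The change of basis has entries in `B`, which `G` fixes, so it multiplies the conjugate matrix
by an invertible matrix. -/
theorem associated_det_conjugateMatrix (e e' : Module.Basis G B A) :
    Associated (conjugateMatrix G e).det (conjugateMatrix G e').det := by
  have hc : SMulCommClass G B A := IsGaloisGroup.commutes
  have h : conjugateMatrix G e' = conjugateMatrix G e * (e.toMatrix e').map (algebraMap B A) := by
    ext g k
    simp only [conjugateMatrix, Matrix.mul_apply, Matrix.map_apply, Matrix.of_apply]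
    conv_lhs => rw [← e.sum_toMatrix_smul_self e' k, Finset.smul_sum]
    refine Finset.sum_congr rfl fun i _ => ?_
    rw [smul_comm, Algebra.smul_def, mul_comm]
  have hu : IsUnit ((e.toMatrix e').map (algebraMap B A)).det := by
    have : ((e.toMatrix e').map (algebraMap B A)).det = algebraMap B A (e.toMatrix e').det :=
      (RingHom.map_det _ _).symm
    rw [this, ← Module.Basis.det_apply]
    exact (e.isUnit_det e').map _
  rw [h, Matrix.det_mul]
  exact associated_mul_unit_right _ _ hu

variable [IsDomain A] [FaithfulSMul B A]

theorem det_conjugateMatrix_ne_zero {β : A} (hβ : Algebra.adjoin B {β} = ⊤)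
    (e : Module.Basis G B A) : (conjugateMatrix G e).det ≠ 0 := by
  obtain ⟨b, hb⟩ := IsGaloisGroup.exists_basis_pow (G := G) hβ
  let σ := (Fintype.equivFin G).symm
  have h := IsGaloisGroup.det_vandermonde_ne_zero (G := G) hβ σ
  have h2 : (conjugateMatrix G (b.reindex σ)).submatrix σ σ =
      Matrix.vandermonde fun i => σ i • β := by
    ext i j
    simp [conjugateMatrix, Matrix.vandermonde_apply, hb]
  rw [← h2, Matrix.det_submatrix_equiv_self] at h
  exact (associated_det_conjugateMatrix _ e).ne_zero_iff.mp h

theorem two_mul_ord_det_conjugateMatrix [IsDiscreteValuationRing A] {β : A}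
    (hβ : Algebra.adjoin B {β} = ⊤) (e : Module.Basis G B A) :
    2 * Ring.ord A (conjugateMatrix G e).det =
      Fintype.card G * ∑ g ∈ Finset.univ.erase (1 : G), Ring.ord A (g • β - β) := by
  obtain ⟨b, hb⟩ := IsGaloisGroup.exists_basis_pow (G := G) hβ
  let σ := (Fintype.equivFin G).symm
  have h := IsGaloisGroup.two_mul_ord_det_vandermonde (G := G) hβ σ
  have h2 : (conjugateMatrix G (b.reindex σ)).submatrix σ σ =
      Matrix.vandermonde fun i => σ i • β := by
    ext i j
    simp [conjugateMatrix, Matrix.vandermonde_apply, hb]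
  rw [← h2, Matrix.det_submatrix_equiv_self] at h
  rw [← Ring.ord_eq_of_associated (associated_det_conjugateMatrix (b.reindex σ) e), h]

end ConjugateMatrix

/-- The equivariant maps from a `D`-set to a ring with `D`-action. -/
def equivariantMaps (D A Y : Type*) [SMul D A] [SMul D Y] : Set (Y → A) :=
  {φ | ∀ (g : D) (y : Y), φ (g • y) = g • φ y}

/-- The colength of the lattice spanned by the equivariant maps `Y → A` among all maps. -/
def permLength (D A Y : Type*) [CommRing A] [SMul D A] [SMul D Y] : ℕ∞ :=
  Module.length A ((Y → A) ⧸ Submodule.span A (equivariantMaps D A Y))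

/-! ### Transitive permutation representations -/

section Coset

variable {D R A : Type*} [Group D] [CommRing R] [CommRing A] [Algebra R A] [MulSemiringAction D A] [IsGaloisGroup D R A]

/-- An equivariant map on `D ⧸ H` is determined by its value at the trivial coset, which can be any
`H`-invariant element. A basis of the invariants therefore gives the columns of the matrix. -/
theorem span_equivariantMaps_quotient (H : Subgroup D) {ι : Type*} [Fintype ι]
    (b : Module.Basis ι R (FixedPoints.subalgebra R A H)) :
    Submodule.span A (equivariantMaps D A (D ⧸ H)) = LinearMap.range
      (Matrix.of fun (y : D ⧸ H) (j : ι) => y.out • (b j : A)).mulVecLin := by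
  have hc : SMulCommClass D R A := IsGaloisGroup.commutes
  rw [Matrix.range_mulVecLin]
  have hout : ∀ (g : D) (y : D ⧸ H) (x : FixedPoints.subalgebra R A H),
      (g • y).out • (x : A) = g • y.out • (x : A) := by
    intro g y x
    have h1 : ((g • y).out : D ⧸ H) = ((g * y.out : D) : D ⧸ H) := by
      rw [QuotientGroup.out_eq', ← smul_eq_mul, ← MulAction.Quotient.smul_coe,
        QuotientGroup.out_eq']
    rw [eq_comm, QuotientGroup.eq] at h1
    have h2 := x.2 ⟨_, h1⟩
    rw [Subgroup.mk_smul, mul_smul, inv_smul_eq_iff] at h2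
    rw [h2, mul_smul]
  apply le_antisymm
  · rw [Submodule.span_le]
    intro φ hφ
    have h1 : ∀ h : D, h ∈ H → h • φ ((1 : D) : D ⧸ H) = φ ((1 : D) : D ⧸ H) := fun h hh => by
      rw [← hφ]
      congr 1
      rw [MulAction.Quotient.smul_coe, smul_eq_mul, mul_one, QuotientGroup.eq]
      simpa using hh
    let x : FixedPoints.subalgebra R A H := ⟨φ ((1 : D) : D ⧸ H), fun h => h1 h h.2⟩
    have hx : φ = ∑ j, algebraMap R A (b.repr x j) • fun y : D ⧸ H => y.out • (b j : A) := by
      funext y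
      have h2 : φ y = y.out • (x : A) := by
        change φ y = y.out • φ _
        rw [← hφ, MulAction.Quotient.smul_coe, smul_eq_mul, mul_one, QuotientGroup.out_eq']
      rw [h2]
      conv_lhs => rw [← b.sum_repr x]
      simp only [AddSubmonoidClass.coe_finsetSum, Subalgebra.coe_smul, Finset.smul_sum, Finset.sum_apply,
        Pi.smul_apply, smul_eq_mul]
      exact Finset.sum_congr rfl fun j _ => by rw [smul_comm, Algebra.smul_def]
    rw [SetLike.mem_coe, hx]
    exact Submodule.sum_mem _ fun j _ =>
      Submodule.smul_mem _ _ (Submodule.subset_span ⟨j, rfl⟩)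
  · refine Submodule.span_mono ?_
    rintro _ ⟨j, rfl⟩ g y
    exact hout g y (b j)

variable [Fintype D] [DecidableEq D] [IsDomain R] [IsPrincipalIdealRing R] [FaithfulSMul R A]
  [IsDomain A] [IsDiscreteValuationRing A]

/-- A discriminant formula for the tower `R ⊆ A^H ⊆ A`: multiplicativity of the determinant of
conjugates isolates the factor `det P` whose order is the length. It is written without subtraction
because the values lie in `ℕ∞`. -/
theorem permLength_quotient {β : A} (hβ : Algebra.adjoin R {β} = ⊤) (H : Subgroup D)
    [Fintype H] [Fintype (D ⧸ H)] :
    permLength D A (D ⧸ H) ≠ ⊤ ∧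
    Fintype.card (D ⧸ H) * ∑ g ∈ Finset.univ.erase (1 : D), Ring.ord A (g • β - β) =
      Fintype.card (D ⧸ H) * ∑ g ∈ Finset.univ.erase (1 : H), Ring.ord A (g • β - β) +
        2 * permLength D A (D ⧸ H) := by
  classical
  have hc : SMulCommClass D R A := IsGaloisGroup.commutes
  have hDH : Fintype.card D = Fintype.card (D ⧸ H) * Fintype.card H := by
    simpa only [Nat.card_eq_fintype_card] using H.card_eq_card_quotient_mul_card_subgroup
  let B := FixedPoints.subalgebra R A H
  obtain ⟨c, -⟩ := IsGaloisGroup.exists_basis_pow (G := D) hβ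
  have hfin : Module.Finite R A := Module.Finite.of_basis c
  have htf : Module.IsTorsionFree R A := inferInstance
  have hfinB : Module.Finite R B := Module.Finite.of_injective B.toSubmodule.subtype
    (Submodule.subtype_injective _)
  have htfB : Module.IsTorsionFree R B := inferInstance
  have hfree : Module.Free R B := inferInstance
  have hβ' : Algebra.adjoin B {β} = ⊤ := by
    rw [eq_top_iff]
    intro x _
    have h1 : Algebra.adjoin R {β} ≤ (Algebra.adjoin B {β}).restrictScalars R :=
      Algebra.adjoin_le Algebra.subset_adjoin
    exact h1 (hβ ▸ Algebra.mem_top)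
  obtain ⟨e', -⟩ := IsGaloisGroup.exists_basis_pow (G := H) hβ'
  let e : Module.Basis H B A := e'.reindex (Fintype.equivFin H).symm
  have hcard : Fintype.card (Module.Free.ChooseBasisIndex R B) = Fintype.card (D ⧸ H) := by
    have h1 := Fintype.card_congr (((Module.Free.chooseBasis R B).smulTower e).indexEquiv c)
    rw [Fintype.card_prod, Fintype.card_fin, hDH] at h1
    exact Nat.eq_of_mul_eq_mul_right Fintype.card_pos h1
  let b : Module.Basis (D ⧸ H) R B :=
    (Module.Free.chooseBasis R B).reindex (Fintype.equivOfCardEq hcard)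
  let E : H × (D ⧸ H) ≃ D :=
    { toFun := fun p => p.2.out * p.1
      invFun := fun d => (⟨(d : D ⧸ H).out⁻¹ * d, QuotientGroup.eq.mp (QuotientGroup.out_eq' _)⟩, d)
      left_inv := fun p => by
        have h1 : ((p.2.out * p.1 : D) : D ⧸ H) = p.2 := by
          rw [QuotientGroup.mk_mul_of_mem _ p.1.2, QuotientGroup.out_eq']
        refine Prod.ext (Subtype.ext ?_) h1
        simp only [h1, inv_mul_cancel_left]
      right_inv := fun d => by simp }
  have hE : ∀ h y, E (h, y) = y.out * h := fun _ _ => rfl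
  let be : Module.Basis D R A :=
    ((b.smulTower e).reindex (Equiv.prodComm _ _)).reindex E
  let P : Matrix (D ⧸ H) (D ⧸ H) A := Matrix.of fun y j => y.out • (b j : A)
  -- In the basis `b j * e k`, the element `y.out * h` acts by `y.out • b j` times `y.out • (h • e
  -- k)`, since `h` fixes `b j`. Hence `det = (∏ y, y.out • det Q) * (det P) ^ |H|`, with `Q` the
  -- conjugate matrix of `A/A^H`.
  have hM : (conjugateMatrix D be).submatrix E E =
      Matrix.blockDiagonal (fun y : D ⧸ H => Matrix.of fun h k : H => y.out • (h • e k)) *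
        Matrix.kronecker (1 : Matrix H H A) P := by
    ext ⟨h, y⟩ ⟨k, j⟩
    have h1 : be (E (k, j)) = (b j : A) * e k := by
      simp [be, Algebra.smul_def]
    have h2 : (h : D) • (b j : A) = b j := (b j).2 h
    rw [Matrix.submatrix_apply, conjugateMatrix, Matrix.of_apply, h1, hE, mul_smul, smul_mul',
      smul_mul', h2, Matrix.mul_apply, Fintype.sum_prod_type, Finset.sum_eq_single k,
      Finset.sum_eq_single y]
    · simp [P, Matrix.blockDiagonal_apply, Subgroup.smul_def, mul_comm]
    · intro z _ hz
      simp [Matrix.blockDiagonal_apply, hz.symm]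
    · simp
    · intro l _ hl
      refine Finset.sum_eq_zero fun z _ => ?_
      simp [hl]
    · simp
  have hdet := congrArg Matrix.det hM
  rw [Matrix.det_submatrix_equiv_self, Matrix.det_mul, Matrix.det_blockDiagonal,
    Matrix.kronecker, Matrix.det_kronecker, Matrix.det_one, one_pow, one_mul] at hdet
  have hQ : ∀ y : D ⧸ H, (Matrix.of fun h k : H => y.out • (h • e k)).det =
      y.out • (conjugateMatrix H e).det := fun y =>
    (RingHom.map_det (MulSemiringAction.toRingHom D A y.out) (conjugateMatrix H e)).symm
  simp only [hQ] at hdet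
  have hD := two_mul_ord_det_conjugateMatrix hβ be
  have hD0 := det_conjugateMatrix_ne_zero hβ be
  have hH := two_mul_ord_det_conjugateMatrix hβ' e
  have hP0 : P.det ≠ 0 := fun h0 => hD0 (by rw [hdet, h0, zero_pow Fintype.card_ne_zero, mul_zero])
  have hperm : permLength D A (D ⧸ H) = Ring.ord A P.det := by
    rw [permLength, span_equivariantMaps_quotient H b, ← Matrix.length_quotient_range_mulVecLin P hP0]
  have hH0 := det_conjugateMatrix_ne_zero hβ' e
  have hQ0 : ∀ y ∈ (Finset.univ : Finset (D ⧸ H)), y.out • (conjugateMatrix H e).det ≠ 0 :=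
    fun y _ => by rwa [Ne, smul_eq_zero_iff_eq]
  rw [hdet, Ring.ord_mul _ (mem_nonZeroDivisors_of_ne_zero (pow_ne_zero _ hP0)),
    Ring.ord_prod _ _ hQ0, Ring.ord_pow (mem_nonZeroDivisors_of_ne_zero hP0), ← hperm] at hD
  simp only [IsDiscreteValuationRing.ord_smul, Finset.sum_const, Finset.card_univ,
    nsmul_eq_mul] at hD
  refine ⟨hperm ▸ Ring.ord_ne_top (mem_nonZeroDivisors_of_ne_zero hP0), ?_⟩
  -- Every term of `hD` carries the factor `|H|`, because `|D| = |D ⧸ H| |H|` and `det P` occurs to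
  -- the power `|H|`; it is cancelled.
  refine (ENat.mul_right_strictMono (a := Fintype.card H) (by simp) (by simp)).injective ?_
  have h1 : (2 : ℕ∞) * ((Fintype.card (D ⧸ H) : ℕ∞) * Ring.ord A (conjugateMatrix H e).det +
      Fintype.card H * permLength D A (D ⧸ H)) = Fintype.card (D ⧸ H) *
      (2 * Ring.ord A (conjugateMatrix H e).det) + Fintype.card H *
        (2 * permLength D A (D ⧸ H)) := by ring
  rw [h1, hH, hDH, Nat.cast_mul] at hD
  calc _ = _ := by ring
    _ = _ := hD.symm
    _ = _ := by ring

end Coset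

theorem Submodule.map_span_eq_of_forall_mem_iff {A M M' : Type*} [Ring A] [AddCommGroup M]
    [Module A M] [AddCommGroup M'] [Module A M'] (e : M ≃ₗ[A] M') {S : Set M} {S' : Set M'}
    (h : ∀ x, x ∈ S ↔ e x ∈ S') :
    (Submodule.span A S).map (e : M →ₗ[A] M') = Submodule.span A S' := by
  rw [Submodule.map_span]
  congr 1
  ext y
  constructor
  · rintro ⟨x, hx, rfl⟩
    exact (h x).mp hx
  · intro hy
    exact ⟨e.symm y, (h _).mpr (by simpa using hy), by simp⟩

theorem Module.length_quotient_span_congr {A M M' : Type*} [Ring A] [AddCommGroup M]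
    [Module A M] [AddCommGroup M'] [Module A M'] (e : M ≃ₗ[A] M') {S : Set M} {S' : Set M'}
    (h : ∀ x, x ∈ S ↔ e x ∈ S') :
    Module.length A (M ⧸ Submodule.span A S) = Module.length A (M' ⧸ Submodule.span A S') :=
  (Submodule.Quotient.equiv _ _ e (Submodule.map_span_eq_of_forall_mem_iff e h)).length_eq

/-! ### Invariance and additivity of the colength over `D`-sets -/

section PermLength

variable {D A : Type*} [Group D] [CommRing A] [MulSemiringAction D A]

theorem permLength_congr {Y Y' : Type*} [MulAction D Y] [MulAction D Y'] (e : Y ≃ Y')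
    (he : ∀ (g : D) y, e (g • y) = g • e y) : permLength D A Y = permLength D A Y' := by
  refine Module.length_quotient_span_congr (LinearEquiv.funCongrLeft A A e.symm) fun φ => ?_
  constructor
  · intro h g y
    have h1 : e.symm (g • y) = g • e.symm y := by rw [Equiv.symm_apply_eq, he, e.apply_symm_apply]
    simpa [LinearEquiv.funCongrLeft_apply, LinearMap.funLeft_apply, h1] using h g (e.symm y)
  · intro h g y
    have := h g (e y)
    rw [← he] at this
    simpa [LinearEquiv.funCongrLeft_apply, LinearMap.funLeft_apply] using this

/-- Extension by zero from one summand preserves equivariance, so the span is the product of the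
spans. -/
theorem permLength_sigma {ι : Type*} [Fintype ι] (Y : ι → Type*) [∀ i, MulAction D (Y i)] :
    permLength D A (Σ i, Y i) = ∑ i, permLength D A (Y i) := by
  classical
  simp only [permLength]
  rw [← Module.length_pi_of_fintype,
    ← (Submodule.quotientPi fun i => Submodule.span A (equivariantMaps D A (Y i))).length_eq]
  refine (Submodule.Quotient.equiv _ _ (LinearEquiv.piCurry A fun (i : ι) (_ : Y i) => A)
    ?_).length_eq
  apply le_antisymm
  · rw [Submodule.map_span, Submodule.span_le]
    rintro _ ⟨φ, hφ, rfl⟩ i _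
    exact Submodule.subset_span fun g y => hφ g ⟨i, y⟩
  · rw [← Submodule.iSup_map_single, iSup_le_iff]
    intro i
    rw [Submodule.map_span, Submodule.map_span, Submodule.span_le]
    rintro _ ⟨φ, hφ, rfl⟩
    refine Submodule.subset_span ⟨fun p => (Pi.single i φ : ∀ j, Y j → A) p.1 p.2, ?_, rfl⟩
    rintro g ⟨j, y⟩
    change (Pi.single i φ : ∀ j, Y j → A) j (g • y) = g • (Pi.single i φ : ∀ j, Y j → A) j y
    rcases eq_or_ne j i with rfl | hj
    · simpa using hφ g y
    · simp [Pi.single_eq_of_ne hj]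

end PermLength

/-! ### Ramification numbers and the colength of a general permutation representation -/

section RamificationNumber

variable {D R A : Type*} [Group D] [CommRing R] [CommRing A] [Algebra R A]
  [MulSemiringAction D A] [IsGaloisGroup D R A]

/-- The map `x ↦ g • x - x` is `R`-linear and obeys a twisted Leibniz rule, so divisibility
propagates from the generator `β`. -/
theorem smul_sub_dvd_smul_sub {β : A} (hβ : Algebra.adjoin R {β} = ⊤) (g : D) (x : A) :
    g • β - β ∣ g • x - x := by
  have hc : SMulCommClass D R A := IsGaloisGroup.commutes
  have hx : x ∈ Algebra.adjoin R {β} := hβ ▸ Algebra.mem_top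
  induction hx using Algebra.adjoin_induction with
  | mem x hx => rw [Set.mem_singleton_iff.mp hx]
  | algebraMap r => simp [smul_algebraMap]
  | add x y _ _ hx hy =>
    rw [smul_add, add_sub_add_comm]
    exact dvd_add hx hy
  | mul x y _ _ hx hy =>
    have : g • (x * y) - x * y = g • x * (g • y - y) + (g • x - x) * y := by
      rw [smul_mul']; ring
    rw [this]
    exact dvd_add (hy.mul_left _) (hx.mul_right _)

theorem adjoin_smul_eq_top {β : A} (hβ : Algebra.adjoin R {β} = ⊤) (g : D) :
    Algebra.adjoin R {g • β} = ⊤ := by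
  have hc : SMulCommClass D R A := IsGaloisGroup.commutes
  have h := AlgHom.map_adjoin_singleton (MulSemiringAction.toAlgHom R A g) β
  rw [hβ] at h
  have h1 : MulSemiringAction.toAlgHom R A g β = g • β := rfl
  rw [← h1, ← h, Algebra.map_top, AlgHom.range_eq_top]
  exact MulAction.surjective g

/-- Both `β` and `g⁻¹ • β` generate `A`, so `h` moves each by an amount dividing the other. The
ramification number is thus a class function. -/
theorem ord_conj_smul_sub {β : A} (hβ : Algebra.adjoin R {β} = ⊤) [IsDomain A]
    [IsDiscreteValuationRing A] (g h : D) :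
    Ring.ord A ((g * h * g⁻¹) • β - β) = Ring.ord A (h • β - β) := by
  have h1 : (g * h * g⁻¹) • β - β = g • (h • (g⁻¹ • β) - g⁻¹ • β) := by
    rw [smul_sub, smul_inv_smul, mul_smul, mul_smul]
  rw [h1, IsDiscreteValuationRing.ord_smul]
  exact le_antisymm
    (Ring.ord_le_ord_of_dvd (smul_sub_dvd_smul_sub (adjoin_smul_eq_top hβ g⁻¹) h β))
    (Ring.ord_le_ord_of_dvd (smul_sub_dvd_smul_sub hβ h _))

variable [Fintype D] [DecidableEq D] [IsDomain R] [IsPrincipalIdealRing R] [FaithfulSMul R A]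
  [IsDomain A] [IsDiscreteValuationRing A]

omit [Fintype D] [DecidableEq D] in
theorem QuotientGroup.smul_eq_self_iff (H : Subgroup D) (y : D ⧸ H) (g : D) :
    g • y = y ↔ y.out⁻¹ * g * y.out ∈ H := by
  have h : ∀ x : D, (x : D ⧸ H) = y → (g • y = y ↔ x⁻¹ * g * x ∈ H) := by
    rintro x rfl
    rw [MulAction.Quotient.smul_coe, smul_eq_mul, eq_comm, QuotientGroup.eq, mul_assoc]
  exact h _ (QuotientGroup.out_eq' y)

omit [IsDomain R] [IsPrincipalIdealRing R] [FaithfulSMul R A] in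
open Classical in
-- The stabilizer of `y` is the conjugate of `H` by `y.out`, and the ramification number is
-- conjugation invariant.
theorem sum_ord_fixing_quotient {β : A} (hβ : Algebra.adjoin R {β} = ⊤) (H : Subgroup D)
    [Fintype H] (y : D ⧸ H) :
    ∑ g ∈ Finset.univ.erase (1 : D) with g • y = y, Ring.ord A (g • β - β) =
      ∑ g ∈ Finset.univ.erase (1 : H), Ring.ord A (g • β - β) := by
  symm
  have hcancel : ∀ g : D, y.out⁻¹ * (y.out * g * y.out⁻¹) * y.out = g := fun g => by group
  refine Finset.sum_bij (fun h _ => y.out * (h : D) * y.out⁻¹) ?_ ?_ ?_ ?_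
  · intro h hh
    have h1 : (h : D) ≠ 1 := fun h1 => (Finset.mem_erase.mp hh).1 (Subtype.ext h1)
    rw [Finset.mem_filter, Finset.mem_erase, QuotientGroup.smul_eq_self_iff, hcancel]
    exact ⟨⟨fun h2 => h1 (by rwa [mul_inv_eq_one, mul_eq_left] at h2), Finset.mem_univ _⟩, h.2⟩
  · intro h _ h' _ heq
    exact Subtype.ext (mul_left_cancel (mul_right_cancel heq))
  · intro g hg
    rw [Finset.mem_filter, Finset.mem_erase, QuotientGroup.smul_eq_self_iff] at hg
    refine ⟨⟨_, hg.2⟩, Finset.mem_erase.mpr ⟨fun h2 => hg.1.1 ?_, Finset.mem_univ _⟩, by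
      simp only [mul_assoc, mul_inv_cancel_left, mul_inv_cancel, mul_one]⟩
    have h3 : y.out⁻¹ * g * y.out = 1 := congrArg Subtype.val h2
    rwa [mul_assoc, inv_mul_eq_one, eq_comm, mul_eq_right] at h3
  · intro h _
    rw [ord_conj_smul_sub hβ y.out (h : D), Subgroup.smul_def]

open Classical in
-- Decomposition into orbits. Moving the fixing pairs to the left, `2 * permLength` is the sum of
-- `ord (g • β - β)` over the pairs with `g • y ≠ y`.
theorem permLength_formula {β : A} (hβ : Algebra.adjoin R {β} = ⊤) (Y : Type*) [Fintype Y]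
    [MulAction D Y] :
    permLength D A Y ≠ ⊤ ∧
    ∑ _y : Y, ∑ g ∈ Finset.univ.erase (1 : D), Ring.ord A (g • β - β) =
      ∑ y : Y, ∑ g ∈ Finset.univ.erase (1 : D) with g • y = y, Ring.ord A (g • β - β) +
        2 * permLength D A Y := by
  let Ω := Quotient (MulAction.orbitRel D Y)
  let e : (Σ ω : Ω, D ⧸ MulAction.stabilizer D ω.out) ≃ Y :=
    (MulAction.selfEquivSigmaOrbitsQuotientStabilizer D Y).symm
  have he : ∀ (g : D) p, e (g • p) = g • e p := by
    rintro g ⟨ω, q⟩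
    induction q using QuotientGroup.induction_on with
    | H x => exact mul_smul g x ω.out
  have hq : ∀ ω : Ω, _ := fun ω => permLength_quotient hβ (MulAction.stabilizer D ω.out)
  rw [← permLength_congr e he, permLength_sigma]
  refine ⟨by simpa using fun ω => (hq ω).1, ?_⟩
  rw [← e.sum_comp, ← e.sum_comp, Fintype.sum_sigma, Fintype.sum_sigma, Finset.mul_sum,
    ← Finset.sum_add_distrib]
  refine Finset.sum_congr rfl fun ω _ => ?_
  have h1 : ∀ (p) (g : D), g • e p = e p ↔ g • p = p := fun p g => by
    rw [← he, e.apply_eq_iff_eq]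
  rw [Finset.sum_const, Finset.card_univ, nsmul_eq_mul, (hq ω).2]
  congr 1
  rw [← nsmul_eq_mul, ← Finset.card_univ, ← Finset.sum_const]
  refine Finset.sum_congr rfl fun q _ => ?_
  refine (sum_ord_fixing_quotient hβ _ q).symm.trans ?_
  refine Finset.sum_congr (Finset.filter_congr fun g _ => ?_) fun _ _ => rfl
  rw [h1]
  constructor
  · rintro h; exact Sigma.ext rfl (heq_of_eq h)
  · intro h; exact eq_of_heq (Sigma.mk.inj h).2

end RamificationNumber

/-- The functions `Y → K` invariant under a subgroup. -/
def permFixed (K : Type*) [Field K] {D : Type*} [Group D] (H : Subgroup D) (Y : Type*)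
    [MulAction D Y] : Submodule K (Y → K) where
  carrier := {f | ∀ g ∈ H, ∀ y, f (g • y) = f y}
  add_mem' := fun ha hb g hg y => by simp [ha g hg y, hb g hg y]
  zero_mem' := fun _ _ _ => rfl
  smul_mem' := fun c f hf g hg y => by simp [hf g hg y]

/-! ### Codimension of invariants by Burnside's count -/

section Burnside

variable (K : Type*) [Field K] {D : Type*} [Group D] (H : Subgroup D) (Y : Type*)
    [MulAction D Y]

/-- Invariant functions are functions on the orbits. -/
def permFixedEquiv : permFixed K H Y ≃ₗ[K] (MulAction.orbitRel.Quotient H Y → K) where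
  toFun f := Quotient.lift f.1 fun a b hab => by
    obtain ⟨h, rfl⟩ := hab
    exact f.2 h h.2 b
  map_add' f f' := by
    funext q
    induction q using Quotient.inductionOn
    rfl
  map_smul' c f := by
    funext q
    induction q using Quotient.inductionOn
    rfl
  invFun f := ⟨fun y => f (Quotient.mk _ y), fun g hg y => congrArg f (Quotient.sound ⟨⟨g, hg⟩, rfl⟩)⟩
  left_inv f := rfl
  right_inv f := by
    funext q
    induction q using Quotient.inductionOn
    rfl

open Classical in
-- The dimension of the invariants is the number of orbits, to which Burnside's lemma applies. The
-- identity fixes every point and is dropped from both counts, since `g • β - β` has finite order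
-- only for `g ≠ 1`.
theorem card_mul_codim_permFixed [Fintype D] [Fintype Y] :
    Nat.card H * Module.finrank K ((Y → K) ⧸ permFixed K H Y) +
      ∑ y : Y, (Finset.card {g ∈ Finset.univ.erase (1 : D) | g • y = y ∧ g ∈ H}) =
      ∑ _y : Y, (Finset.card {g ∈ Finset.univ.erase (1 : D) | g ∈ H}) := by
  have h1 := (permFixed K H Y).finrank_quotient_add_finrank
  rw [(permFixedEquiv K H Y).finrank_eq, Module.finrank_fintype_fun_eq_card,
    Module.finrank_fintype_fun_eq_card] at h1
  have h2 := MulAction.sum_card_fixedBy_eq_card_orbits_mul_card_group H Y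
  have h3 : ∀ p : D → Prop, p 1 → Finset.card {g ∈ Finset.univ.erase (1 : D) | p g} + 1 =
      Finset.card {g : D | p g} := fun p hp => by
    rw [Finset.filter_erase, Finset.card_erase_add_one (by simpa using hp)]
  have h4 : ∑ h : H, Fintype.card (MulAction.fixedBy Y h) =
      ∑ y : Y, Finset.card {g : D | g • y = y ∧ g ∈ H} := by
    have h5 : ∀ h : H, Fintype.card (MulAction.fixedBy Y h) =
        ∑ y : Y, if (h : D) • y = y then 1 else 0 := fun h => by
      rw [← Finset.card_filter, Fintype.card_subtype]
      rfl
    simp only [h5]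
    rw [Finset.sum_comm]
    refine Finset.sum_congr rfl fun y _ => ?_
    rw [← Finset.card_filter]
    refine Finset.card_bij (fun h _ => (h : D)) ?_ ?_ ?_
    · intro h hh
      simpa using hh
    · intro h _ h' _ e
      exact Subtype.ext e
    · intro g hg
      simp only [Finset.mem_filter, Finset.mem_univ, true_and] at hg
      exact ⟨⟨g, hg.2⟩, by simpa using hg.1, rfl⟩
  have h6 : Finset.card {g : D | g ∈ H} = Nat.card H := by
    rw [Nat.card_eq_fintype_card, Fintype.card_subtype]
  rw [h4] at h2
  have h7 : ∑ y : Y, (Finset.card {g ∈ Finset.univ.erase (1 : D) | g • y = y ∧ g ∈ H} + 1) =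
      ∑ y : Y, Finset.card {g : D | g • y = y ∧ g ∈ H} :=
    Finset.sum_congr rfl fun y _ => by
      convert h3 (fun g => g • y = y ∧ g ∈ H) ⟨one_smul _ _, H.one_mem⟩
  have h8 := h3 (fun g => g ∈ H) H.one_mem
  rw [Finset.sum_add_distrib, h2, Finset.sum_const, Finset.card_univ, smul_eq_mul, mul_one,
    ← Nat.card_eq_fintype_card (α := H)] at h7
  rw [Finset.sum_const, Finset.card_univ, smul_eq_mul]
  refine Nat.add_right_cancel (m := Fintype.card Y) ?_
  rw [add_assoc, h7, ← Nat.mul_succ, Nat.succ_eq_add_one, h8, h6, mul_comm, ← add_mul, h1]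

end Burnside

/-! ### The ramification filtration and the identity for permutation representations -/

section Filtration

variable {D A : Type*} [Group D] [CommRing A] [IsDomain A] [IsDiscreteValuationRing A]
  [MulSemiringAction D A]

theorem IsDiscreteValuationRing.mem_maximalIdeal_pow_iff_le_ord {x : A} (hx : x ≠ 0) (n : ℕ) :
    x ∈ IsLocalRing.maximalIdeal A ^ n ↔ (n : ℕ∞) ≤ Ring.ord A x := by
  obtain ⟨ϖ, hϖ⟩ := IsDiscreteValuationRing.exists_irreducible A
  obtain ⟨m, hm⟩ := IsDiscreteValuationRing.associated_pow_irreducible hx hϖ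
  rw [Ring.ord_eq_of_associated hm, Ring.ord_pow (mem_nonZeroDivisors_of_ne_zero hϖ.ne_zero),
    Ring.ord_of_irreducible hϖ, hϖ.maximalIdeal_eq, Ideal.span_singleton_pow,
    Ideal.mem_span_singleton, hm.dvd_iff_dvd_right, pow_dvd_pow_iff hϖ.ne_zero hϖ.not_isUnit]
  simp

/-- The lower ramification groups of a group acting on a local ring. -/
def ramificationFiltration (D A : Type*) [Group D] [CommRing A] [IsLocalRing A]
    [MulSemiringAction D A] (k : ℕ) : Subgroup D :=
  (IsLocalRing.maximalIdeal A ^ (k + 1)).toAddSubgroup.inertia D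

variable {R : Type*} [CommRing R] [Algebra R A] [IsGaloisGroup D R A]

omit [IsDomain A] [IsDiscreteValuationRing A] in
theorem smul_sub_ne_zero_of_adjoin_eq_top {β : A} (hβ : Algebra.adjoin R {β} = ⊤) {g : D}
    (hg : g ≠ 1) : g • β - β ≠ 0 := fun h =>
  hg (IsGaloisGroup.smul_injective_of_adjoin_eq_top R hβ
    (by simpa using sub_eq_zero.mp h : g • β = (1 : D) • β))

/-- By `smul_sub_dvd_smul_sub` the condition on all `x` only needs testing on `β`. -/
theorem mem_ramificationFiltration_iff {β : A} (hβ : Algebra.adjoin R {β} = ⊤) {g : D}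
    (hg : g ≠ 1) (k : ℕ) : g ∈ ramificationFiltration D A k ↔
      ((k + 1 : ℕ) : ℕ∞) ≤ Ring.ord A (g • β - β) := by
  rw [← IsDiscreteValuationRing.mem_maximalIdeal_pow_iff_le_ord
    (smul_sub_ne_zero_of_adjoin_eq_top hβ hg)]
  exact ⟨fun h => h β, fun h x => Ideal.mem_of_dvd _ (smul_sub_dvd_smul_sub hβ g x) h⟩

open Classical in
theorem exists_ramificationFiltration_bound [Finite D] {β : A} (hβ : Algebra.adjoin R {β} = ⊤) :
    ∃ N : ℕ, (∀ k ≥ N, ramificationFiltration D A k = ⊥) ∧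
      ∀ s : Finset D, (1 ∉ s) → ∑ g ∈ s, Ring.ord A (g • β - β) =
        ((∑ k ∈ Finset.range N, Finset.card {g ∈ s | g ∈ ramificationFiltration D A k} : ℕ) : ℕ∞) := by
  have := Fintype.ofFinite D
  -- At `g = 1` the value of `i` carries no meaning; it enters only the bound `∑ g, i g`, where it
  -- does no harm.
  let i : D → ℕ := fun g => (Ring.ord A (g • β - β)).toNat
  have hi : ∀ g : D, g ≠ 1 → (i g : ℕ∞) = Ring.ord A (g • β - β) := fun g hg =>
    ENat.natCast_toNat (Ring.ord_ne_top (mem_nonZeroDivisors_of_ne_zero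
      (smul_sub_ne_zero_of_adjoin_eq_top hβ hg)))
  have hm : ∀ g : D, g ≠ 1 → ∀ k, g ∈ ramificationFiltration D A k ↔ k + 1 ≤ i g :=
    fun g hg k => by rw [mem_ramificationFiltration_iff hβ hg, ← hi g hg, Nat.cast_le]
  have hN : ∀ g, i g ≤ ∑ g, i g := fun g => Finset.single_le_sum_of_canonicallyOrdered (Finset.mem_univ g)
  refine ⟨∑ g, i g, fun k hk => ?_, fun s hs => ?_⟩
  · rw [eq_bot_iff]
    intro g hg
    by_contra h1
    have := (hm g h1 k).mp hg
    have := hN g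
    omega
  -- Counting by layers: `i g` is the number of `k` with `g` in the `k`-th group.
  · simp only [Finset.card_filter]
    rw [Finset.sum_comm, Nat.cast_sum]
    refine Finset.sum_congr rfl fun g hg => ?_
    have hg1 : g ≠ 1 := fun h => hs (h ▸ hg)
    rw [← hi g hg1, ← Finset.card_filter, Nat.cast_inj]
    have : Finset.filter (fun k => g ∈ ramificationFiltration D A k) (Finset.range (∑ g, i g)) =
        Finset.range (i g) := by
      ext k
      have := hN g
      rw [Finset.mem_filter, hm g hg1, Finset.mem_range, Finset.mem_range]
      omega
    rw [this, Finset.card_range]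

variable [Finite D] [IsDomain R] [IsPrincipalIdealRing R] [FaithfulSMul R A]

/-- Burnside's count is summed over the levels `k` and compared with `permLength_formula`, the
common finite term of fixing pairs cancelling. The bound `N` is chosen before `Y`, so that the
identities for two different sets can be subtracted. -/
theorem sum_card_mul_codim_permFixed (K : Type*) [Field K]
    (hβ : ∃ β : A, Algebra.adjoin R {β} = ⊤) :
    ∃ N : ℕ, (∀ k ≥ N, ramificationFiltration D A k = ⊥) ∧
      ∀ (Y : Type*) [Finite Y] [MulAction D Y],
        ((∑ k ∈ Finset.range N, Nat.card (ramificationFiltration D A k) *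
          Module.finrank K ((Y → K) ⧸ permFixed K (ramificationFiltration D A k) Y) : ℕ) : ℕ∞) =
            2 * permLength D A Y := by
  classical
  have := Fintype.ofFinite D
  obtain ⟨β, hβ⟩ := hβ
  obtain ⟨N, hN, hs⟩ := exists_ramificationFiltration_bound (D := D) hβ
  refine ⟨N, hN, fun Y _ _ => ?_⟩
  have := Fintype.ofFinite Y
  obtain ⟨h1, h2⟩ := permLength_formula (D := D) hβ Y
  simp only [hs _ (Finset.notMem_erase _ _), hs (Finset.filter _ (Finset.univ.erase (1 : D))) (by simp),
    Finset.filter_filter] at h2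
  rw [← Nat.cast_sum, ← Nat.cast_sum, Finset.sum_comm] at h2
  rw [Finset.sum_congr rfl fun k _ => (card_mul_codim_permFixed K _ Y).symm,
    Finset.sum_add_distrib, Finset.sum_comm (s := Finset.univ)] at h2
  rw [Nat.cast_add, add_comm] at h2
  exact ENat.add_right_injective_of_ne_top (ENat.natCast_ne_top _) h2

end Filtration

/-! ### Finite algebras over a complete local ring: locality -/

section Henselian

theorem exists_pow_isIdempotentElem {M : Type*} [Monoid M] [Finite M] (a : M) :
    ∃ N ≠ 0, IsIdempotentElem (a ^ N) := by
  obtain ⟨i, j, hij, h⟩ := Finite.exists_ne_map_eq_of_infinite fun n : ℕ => a ^ n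
  wlog hlt : i < j generalizing i j
  · exact this j i hij.symm h.symm (by omega)
  obtain ⟨d, rfl⟩ := Nat.exists_eq_add_of_lt hlt
  have h1 : ∀ t m, a ^ (i + m + t * (d + 1)) = a ^ (i + m) := by
    intro t
    induction t with
    | zero => simp
    | succ t ih =>
      intro m
      have h2 := ih (m + (d + 1))
      rw [show i + m + (t + 1) * (d + 1) = i + (m + (d + 1)) + t * (d + 1) by ring, h2,
        show i + (m + (d + 1)) = (i + d + 1) + m by ring, pow_add, ← h, ← pow_add]
  -- The powers of `a` are periodic of period `d + 1` from exponent `i` on; the chosen exponent is a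
  -- multiple of the period and at least `i`.
  refine ⟨(i + 1) * (d + 1), by positivity, ?_⟩
  have h3 : (i + 1) * (d + 1) = i + (i * d + d + 1) := by ring
  rw [IsIdempotentElem, ← pow_add]
  nth_rewrite 1 [h3]
  rw [h1, ← h3]

theorem Module.Basis.mem_ideal_smul_top_iff {R M ι : Type*} [CommRing R] [AddCommGroup M]
    [Module R M] [Fintype ι] (b : Module.Basis ι R M) (I : Ideal R) (x : M) :
    x ∈ (I • ⊤ : Submodule R M) ↔ ∀ i, b.repr x i ∈ I := by
  constructor
  · intro h i
    have h1 : b.coord i x ∈ (I • ⊤ : Submodule R M).map (b.coord i) := ⟨x, h, rfl⟩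
    rw [Submodule.map_smul''] at h1
    have h2 : (I • (⊤ : Submodule R M).map (b.coord i) : Submodule R R) ≤ I • ⊤ :=
      Submodule.smul_mono le_rfl le_top
    simpa using h2 h1
  · intro h
    rw [← b.sum_repr x]
    exact Submodule.sum_mem _ fun i _ => Submodule.smul_mem_smul (h i) trivial

theorem IsPrecomplete.of_basis {R M ι : Type*} [CommRing R] [AddCommGroup M] [Module R M]
    [Fintype ι] (b : Module.Basis ι R M) (I : Ideal R) [IsPrecomplete I R] :
    IsPrecomplete I M := by
  refine ⟨fun f hf => ?_⟩
  have h1 : ∀ i, ∃ L : R, ∀ n, b.repr (f n) i ≡ L [SMOD (I ^ n • ⊤ : Submodule R R)] := fun i => by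
    refine IsPrecomplete.prec' _ fun {m n} hmn => ?_
    have := SModEq.sub_mem.mp (hf hmn)
    rw [b.mem_ideal_smul_top_iff] at this
    rw [SModEq.sub_mem]
    simpa using this i
  choose L hL using h1
  refine ⟨∑ i, L i • b i, fun n => ?_⟩
  rw [SModEq.sub_mem, b.mem_ideal_smul_top_iff]
  intro i
  have := SModEq.sub_mem.mp (hL i n)
  rw [map_sub, Finsupp.sub_apply, b.repr_sum_self]
  simpa using this

/-- Some power `a ^ N` is idempotent modulo `I`. Hensel lifts it to a root of `X² - X`, which in a
domain is `0` or `1`. In the first case `1 - a` divides the unit `1 - a ^ N`; in the second `a ^ N`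
is a unit. -/
theorem isLocalRing_of_isAdicComplete_of_finite_quotient {A : Type*} [CommRing A] [IsDomain A]
    (I : Ideal A) [IsAdicComplete I A] [Finite (A ⧸ I)] : IsLocalRing A := by
  have hjac : I ≤ Ideal.jacobson ⊥ := IsAdicComplete.le_jacobson_bot I
  refine IsLocalRing.of_isUnit_or_isUnit_one_sub_self fun a => ?_
  obtain ⟨N, hN0, hN⟩ := exists_pow_isIdempotentElem (Ideal.Quotient.mk I a)
  rw [← map_pow] at hN
  have hN' : (a ^ N) * a ^ N - a ^ N ∈ I := by
    rw [← Ideal.Quotient.mk_eq_mk_iff_sub_mem, map_mul]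
    exact hN
  have hmonic : (Polynomial.X ^ 2 - Polynomial.X : Polynomial A).Monic :=
    Polynomial.monic_X_pow_sub (by rw [Polynomial.degree_X]; norm_num)
  obtain ⟨e, he, hea⟩ := HenselianRing.is_henselian (I := I) (Polynomial.X ^ 2 - Polynomial.X)
    hmonic (a ^ N) (by simpa [pow_two] using hN') (by
      -- For an idempotent `e`, the derivative `2e - 1` is its own inverse.
      refine IsUnit.of_mul_eq_one (Ideal.Quotient.mk I (2 * a ^ N - 1)) ?_
      have h1 : (2 * a ^ N - 1) * (2 * a ^ N - 1) - 1 = 4 * (a ^ N * a ^ N - a ^ N) := by ring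
      have h2 : Polynomial.eval (a ^ N) (Polynomial.derivative (Polynomial.X ^ 2 - Polynomial.X :
          Polynomial A)) = 2 * a ^ N - 1 := by simp [one_add_one_eq_two]
      rw [h2, ← map_mul, ← map_one (Ideal.Quotient.mk I), Ideal.Quotient.mk_eq_mk_iff_sub_mem, h1]
      exact I.mul_mem_left _ hN')
  have he' : e = 0 ∨ e = 1 := by
    have h1 : e * (e - 1) = 0 := by
      have : e ^ 2 - e = 0 := by simpa using he
      linear_combination this
    rcases mul_eq_zero.mp h1 with h | h
    · exact Or.inl h
    · exact Or.inr (sub_eq_zero.mp h)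
  have hunit : ∀ x ∈ I, IsUnit (1 - x) := fun x hx => by
    have := Ideal.mem_jacobson_bot.mp (hjac hx) (-1)
    rwa [mul_neg_one, neg_add_eq_sub] at this
  rcases he' with rfl | rfl
  · right
    have h1 : a ^ N ∈ I := by simpa using hea
    exact isUnit_of_dvd_unit (one_sub_dvd_one_sub_pow a N) (hunit _ h1)
  · left
    have h1 := hunit _ hea
    rw [sub_sub_cancel] at h1
    exact (isUnit_pow_iff hN0).mp h1

theorem isLocalRing_of_finite_of_isAdicComplete {R A : Type*} [CommRing R] [IsNoetherianRing R]
    [IsLocalRing R]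
    [Finite (IsLocalRing.ResidueField R)] [IsAdicComplete (IsLocalRing.maximalIdeal R) R]
    [CommRing A] [IsDomain A] [Algebra R A] [Module.Finite R A] [Module.Free R A] :
    IsLocalRing A := by
  let m := IsLocalRing.maximalIdeal R
  have h1 : IsPrecomplete m A := IsPrecomplete.of_basis (Module.Free.chooseBasis R A) m
  have h2 : IsHausdorff m A := inferInstance
  have h3 : IsAdicComplete (m.map (algebraMap R A)) A :=
    { IsHausdorff.map_algebraMap_iff.mpr h2, IsPrecomplete.map_algebraMap_iff.mpr h1 with }
  have h4 : Finite (A ⧸ m.map (algebraMap R A)) := by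
    have : Module.Finite (R ⧸ m) (A ⧸ m.map (algebraMap R A)) := inferInstance
    have : Finite (R ⧸ m) := ‹Finite (IsLocalRing.ResidueField R)›
    exact Module.finite_of_finite (R ⧸ m)
  exact isLocalRing_of_isAdicComplete_of_finite_quotient (m.map (algebraMap R A))

end Henselian

/-! ### Monogenicity of the ring of integers -/

section Monogenic

/-- Any lift `a` of a generator of the residue unit group has `a ^ q - a` in the maximal ideal. If
it lies in the square, replacing `a` by `a + ϖ` changes it by `-ϖ` modulo the square, because `q`
lies in the maximal ideal. -/
theorem exists_irreducible_pow_sub_self {A : Type*} [CommRing A] [IsDomain A]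
    [IsDiscreteValuationRing A] [Finite (IsLocalRing.ResidueField A)] :
    ∃ β : A, (∀ x : A, x ∈ IsLocalRing.maximalIdeal A ∨
      ∃ n : ℕ, x - β ^ n ∈ IsLocalRing.maximalIdeal A) ∧
      ∃ q : ℕ, Irreducible (β ^ q - β) := by
  classical
  have := Fintype.ofFinite (IsLocalRing.ResidueField A)
  let q := Fintype.card (IsLocalRing.ResidueField A)
  have hres : ∀ x : A, x ∈ IsLocalRing.maximalIdeal A ↔ IsLocalRing.residue A x = 0 := fun x =>
    (IsLocalRing.residue_eq_zero_iff x).symm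
  obtain ⟨u, hu⟩ := IsCyclic.exists_monoid_generator (α := (IsLocalRing.ResidueField A)ˣ)
  obtain ⟨a, ha⟩ := IsLocalRing.residue_surjective (u : IsLocalRing.ResidueField A)
  obtain ⟨ϖ, hϖ⟩ := IsDiscreteValuationRing.exists_irreducible A
  have hgen : ∀ β : A, IsLocalRing.residue A β = u → ∀ x : A, x ∈ IsLocalRing.maximalIdeal A ∨
      ∃ n : ℕ, x - β ^ n ∈ IsLocalRing.maximalIdeal A := fun β hβ x => by
    rw [or_iff_not_imp_left, hres]
    intro hx
    obtain ⟨n, hn⟩ := Submonoid.mem_powers_iff _ _ |>.mp (hu (Units.mk0 _ hx))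
    refine ⟨n, ?_⟩
    rw [hres, map_sub, map_pow, hβ, ← Units.val_pow_eq_pow_val, hn, Units.val_mk0, sub_self]
  have hirr : ∀ x : A, x ∈ IsLocalRing.maximalIdeal A → x ∉ IsLocalRing.maximalIdeal A ^ 2 →
      Irreducible x := fun x hx hx2 => by
    have hϖm := hϖ.maximalIdeal_eq
    rw [hϖm, Ideal.mem_span_singleton] at hx
    obtain ⟨c, rfl⟩ := hx
    have hc : IsUnit c := by
      by_contra hc
      refine hx2 ?_
      rw [pow_two]
      exact Ideal.mul_mem_mul (hϖm ▸ Ideal.mem_span_singleton_self ϖ) hc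
    rwa [irreducible_mul_isUnit hc]
  have hmem : ∀ β : A, IsLocalRing.residue A β = u → β ^ q - β ∈ IsLocalRing.maximalIdeal A :=
    fun β hβ => by
      rw [hres, map_sub, map_pow, FiniteField.pow_card, sub_self]
  by_cases h : a ^ q - a ∈ IsLocalRing.maximalIdeal A ^ 2
  · have hϖm : ϖ ∈ IsLocalRing.maximalIdeal A :=
      hϖ.maximalIdeal_eq ▸ Ideal.mem_span_singleton_self ϖ
    have hb : IsLocalRing.residue A (a + ϖ) = u := by
      rw [map_add, (hres ϖ).mp hϖm, ha, add_zero]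
    refine ⟨a + ϖ, hgen _ hb, q, hirr _ (hmem _ hb) fun h2 => ?_⟩
    obtain ⟨c, hc⟩ := Polynomial.binomExpansion (Polynomial.X ^ q) a ϖ
    simp only [Polynomial.eval_pow, Polynomial.eval_X, Polynomial.derivative_X_pow,
      Polynomial.eval_mul, Polynomial.eval_natCast, map_natCast] at hc
    have hq : (q : A) ∈ IsLocalRing.maximalIdeal A := by
      rw [hres, map_natCast]
      exact FiniteField.cast_card_eq_zero _
    have h3 : ϖ ∈ IsLocalRing.maximalIdeal A ^ 2 := by
      have h4 : ϖ = (a ^ q - a) - ((a + ϖ) ^ q - (a + ϖ)) + (q * ϖ) * a ^ (q - 1) + c * ϖ ^ 2 := by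
        rw [hc]; ring
      rw [h4]
      refine add_mem (add_mem (sub_mem h h2) (Ideal.mul_mem_right _ _ ?_))
        (Ideal.mul_mem_left _ _ (Ideal.pow_mem_pow hϖm 2))
      rw [pow_two]
      exact Ideal.mul_mem_mul hq hϖm
    rw [hϖ.maximalIdeal_eq, Ideal.span_singleton_pow, Ideal.mem_span_singleton] at h3
    have := (pow_dvd_pow_iff hϖ.ne_zero hϖ.not_isUnit (n := 2) (m := 1)).mp (by simpa using h3)
    omega
  · exact ⟨a, hgen a ha, q, hirr _ (hmem a ha) h⟩

/-- `R[β]` contains representatives of all residues and a uniformizer, so it approximates `A` modulo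
every power of the maximal ideal. For the power equal to the extension of the maximal ideal of `R`,
which exists by `hR`, Nakayama concludes. -/
theorem exists_adjoin_eq_top {R A : Type*} [CommRing R] [IsLocalRing R] [CommRing A] [IsDomain A]
    [IsDiscreteValuationRing A] [Finite (IsLocalRing.ResidueField A)] [Algebra R A]
    [Module.Finite R A] (hR : (IsLocalRing.maximalIdeal R).map (algebraMap R A) ≠ ⊥) :
    ∃ β : A, Algebra.adjoin R {β} = ⊤ := by
  obtain ⟨β, hβ, q, hq⟩ := exists_irreducible_pow_sub_self (A := A)
  refine ⟨β, ?_⟩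
  let S := Algebra.adjoin R {β}
  have hβS : β ∈ S := Algebra.self_mem_adjoin_singleton R β
  have h1 : ∀ n : ℕ, ∀ x : A, ∃ s ∈ S, x - s ∈ IsLocalRing.maximalIdeal A ^ n := by
    intro n
    induction n with
    | zero => exact fun x => ⟨0, S.zero_mem, by simp⟩
    | succ n ih =>
      intro x
      obtain ⟨s, hs, hxs⟩ := ih x
      rw [hq.maximalIdeal_eq, Ideal.span_singleton_pow, Ideal.mem_span_singleton] at hxs
      obtain ⟨y, hy⟩ := hxs
      have h2 : ∃ t ∈ S, y - t ∈ IsLocalRing.maximalIdeal A := by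
        rcases hβ y with h | ⟨k, hk⟩
        · exact ⟨0, S.zero_mem, by simpa using h⟩
        · exact ⟨β ^ k, S.pow_mem hβS k, hk⟩
      obtain ⟨t, ht, hyt⟩ := h2
      refine ⟨s + (β ^ q - β) ^ n * t, S.add_mem hs (S.mul_mem
        (S.pow_mem (S.sub_mem (S.pow_mem hβS q) hβS) n) ht), ?_⟩
      rw [← sub_sub, hy, ← mul_sub, pow_succ]
      refine Ideal.mul_mem_mul (Ideal.pow_mem_pow ?_ n) hyt
      exact hq.maximalIdeal_eq ▸ Ideal.mem_span_singleton_self _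
  obtain ⟨e, he⟩ := exists_maximalIdeal_pow_eq_of_principal A (IsPrincipalIdealRing.principal _) _ hR
  have h3 : (⊤ : Submodule R A) ≤ S.toSubmodule := by
    refine Submodule.le_of_le_smul_of_le_jacobson_bot (I := IsLocalRing.maximalIdeal R)
      Module.Finite.fg_top (IsLocalRing.maximalIdeal_le_jacobson _) fun x _ => ?_
    obtain ⟨s, hs, hxs⟩ := h1 e x
    rw [← he] at hxs
    rw [Submodule.mem_sup]
    refine ⟨s, hs, x - s, ?_, by ring⟩
    rw [Ideal.smul_top_eq_map]
    exact hxs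
  exact eq_top_iff.mpr fun x _ => h3 trivial

end Monogenic

theorem isLocalHom_algebraMap_of_isIntegral {R A : Type*} [CommRing R] [CommRing A] [Algebra R A]
    [FaithfulSMul R A] [Algebra.IsIntegral R A] : IsLocalHom (algebraMap R A) := inferInstance

/-! ### Order of the inertia group and residue degree -/

section Inertia

variable {D R A : Type*} [Group D] [Finite D] [CommRing R] [IsLocalRing R] [CommRing A]
  [IsLocalRing A] [Algebra R A] [IsLocalHom (algebraMap R A)] [MulSemiringAction D A]
  [IsGaloisGroup D R A] [Finite (IsLocalRing.ResidueField R)]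

/-- This is `e f = |D|`: since `A` is local, there is only one prime above that of `R`. -/
theorem card_ramificationFiltration_zero_mul_finrank :
    Nat.card (ramificationFiltration D A 0) *
      Module.finrank (IsLocalRing.ResidueField R) (IsLocalRing.ResidueField A) = Nat.card D := by
  let p := IsLocalRing.maximalIdeal R
  let P := IsLocalRing.maximalIdeal A
  have : Algebra.IsInvariant R A D := IsGaloisGroup.isInvariant
  have hint : Algebra.IsIntegral R A := IsGaloisGroup.isInvariant (G := D) |>.isIntegral
  have hP : P.LiesOver p := inferInstance
  have hfin : Finite (R ⧸ p) := ‹Finite (IsLocalRing.ResidueField R)›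
  have h := Ideal.ncard_primesOver_mul_card_inertia_mul_finrank (G := D) p P
  have h1 : p.primesOver A = {P} := by
    ext Q
    constructor
    · rintro ⟨hQ, hQp⟩
      have h2 : (Q.comap (algebraMap R A)).IsMaximal := by
        rw [← Ideal.under_def, ← hQp.over]
        exact inferInstanceAs (IsLocalRing.maximalIdeal R).IsMaximal
      have : Q.IsMaximal := Ideal.isMaximal_of_isIntegral_of_isMaximal_comap (R := R) Q h2
      exact IsLocalRing.eq_maximalIdeal this
    · rintro rfl
      exact ⟨inferInstance, hP⟩
  rw [h1, Set.ncard_singleton, one_mul, Ideal.inertiaDeg_eq_of_isMaximal p P] at h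
  rw [← h, ramificationFiltration, zero_add, pow_one]
  rfl

end Inertia

/-! ### Integers of a finite Galois extension of a local field -/

section LocalField

variable (K : Type*) [Field K] [ValuativeRel K] [TopologicalSpace K]
  [IsNonarchimedeanLocalField K]

theorem IsNonarchimedeanLocalField.isAdicComplete :
    IsAdicComplete (IsLocalRing.maximalIdeal 𝒪[K]) 𝒪[K] := by
  let _ := IsTopologicalAddGroup.rightUniformSpace K
  have := isUniformAddGroup_of_addCommGroup (G := K)
  infer_instance

variable (L : Type*) [Field L] [Algebra K L] [FiniteDimensional K L] [IsGalois K L]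

theorem finite_integralClosure : Module.Finite 𝒪[K] (integralClosure 𝒪[K] L) :=
  IsIntegralClosure.finite 𝒪[K] K L _

theorem free_integralClosure : Module.Free 𝒪[K] (integralClosure 𝒪[K] L) :=
  have := finite_integralClosure K L
  Module.free_of_finite_type_torsion_free'

theorem isLocalRing_integralClosure : IsLocalRing (integralClosure 𝒪[K] L) :=
  have := finite_integralClosure K L
  have := free_integralClosure K L
  have := IsNonarchimedeanLocalField.isAdicComplete K
  isLocalRing_of_finite_of_isAdicComplete (R := 𝒪[K])

omit [FiniteDimensional K L] in
theorem faithfulSMul_integralClosure : FaithfulSMul 𝒪[K] (integralClosure 𝒪[K] L) :=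
  (faithfulSMul_iff_algebraMap_injective _ _).mpr
    (Module.isTorsionFree_iff_algebraMap_injective.mp inferInstance)

theorem isDiscreteValuationRing_integralClosure :
    IsDiscreteValuationRing (integralClosure 𝒪[K] L) := by
  have := isLocalRing_integralClosure K L
  have := faithfulSMul_integralClosure K L
  have : IsDedekindDomain (integralClosure 𝒪[K] L) := integralClosure.isDedekindDomain 𝒪[K] K L
  have h : ¬ IsField (integralClosure 𝒪[K] L) := fun h =>
    IsDiscreteValuationRing.not_isField 𝒪[K] <|
      (Algebra.IsIntegral.isField_iff_isField (FaithfulSMul.algebraMap_injective _ _)).mpr h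
  exact ((IsDiscreteValuationRing.TFAE _ h).out 0 2).mpr this

omit [TopologicalSpace K] [IsNonarchimedeanLocalField K] in
theorem isGaloisGroup_integralClosure :
    IsGaloisGroup Gal(L/K) 𝒪[K] (integralClosure 𝒪[K] L) :=
  have : IsFractionRing (integralClosure 𝒪[K] L) L :=
    integralClosure.isFractionRing_of_finite_extension K L
  IsGaloisGroup.of_isFractionRing Gal(L/K) 𝒪[K] (integralClosure 𝒪[K] L) K L

omit [TopologicalSpace K] [IsNonarchimedeanLocalField K] [FiniteDimensional K L]
  [IsGalois K L] in
theorem lowerRamificationGroup_eq [IsLocalRing (integralClosure 𝒪[K] L)] (k : ℕ) :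
    lowerRamificationGroup K L k =
      ramificationFiltration Gal(L/K) (integralClosure 𝒪[K] L) k := by
  rw [lowerRamificationGroup, ramificationFiltration, IsLocalRing.ringJacobson_eq_maximalIdeal]

omit [FiniteDimensional K L] in
theorem isLocalHom_integralClosure :
    IsLocalHom (algebraMap 𝒪[K] (integralClosure 𝒪[K] L)) :=
  have := faithfulSMul_integralClosure K L
  isLocalHom_algebraMap_of_isIntegral (R := 𝒪[K])

theorem exists_adjoin_eq_top_integralClosure :
    ∃ β : integralClosure 𝒪[K] L, Algebra.adjoin 𝒪[K] {β} = ⊤ := by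
  have := finite_integralClosure K L
  have := isDiscreteValuationRing_integralClosure K L
  have := faithfulSMul_integralClosure K L
  have := isLocalHom_integralClosure K L
  have : Finite (IsLocalRing.ResidueField (integralClosure 𝒪[K] L)) :=
    Module.finite_of_finite (IsLocalRing.ResidueField 𝒪[K])
  refine exists_adjoin_eq_top fun h => IsDiscreteValuationRing.not_a_field 𝒪[K] ?_
  exact (Ideal.map_eq_bot_iff_of_injective (FaithfulSMul.algebraMap_injective _ _)).mp h

end LocalField

/-! ### Products of lattices -/

def Submodule.quotientProdEquiv {A M N : Type*} [Ring A] [AddCommGroup M] [Module A M]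
    [AddCommGroup N] [Module A N] (P : Submodule A M) (Q : Submodule A N) :
    ((M × N) ⧸ P.prod Q) ≃ₗ[A] (M ⧸ P) × (N ⧸ Q) :=
  (Submodule.quotEquivOfEq _ _ (by rw [LinearMap.ker_prodMap, ker_mkQ, ker_mkQ])).trans
    (LinearMap.quotKerEquivOfSurjective (P.mkQ.prodMap Q.mkQ)
      (Function.Surjective.prodMap P.mkQ_surjective Q.mkQ_surjective))

theorem Module.length_quotient_span_prod {A M M₁ M₂ : Type*} [Ring A] [AddCommGroup M]
    [Module A M] [AddCommGroup M₁] [Module A M₁] [AddCommGroup M₂] [Module A M₂]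
    (e : M ≃ₗ[A] M₁ × M₂) {S : Set M} {S₁ : Set M₁} {S₂ : Set M₂} (h₁ : 0 ∈ S₁) (h₂ : 0 ∈ S₂)
    (h : ∀ x, x ∈ S ↔ (e x).1 ∈ S₁ ∧ (e x).2 ∈ S₂) :
    Module.length A (M ⧸ Submodule.span A S) =
      Module.length A (M₁ ⧸ Submodule.span A S₁) + Module.length A (M₂ ⧸ Submodule.span A S₂) := by
  rw [Module.length_quotient_span_congr e (S' := S₁ ×ˢ S₂) h, Submodule.span_prod_eq _ h₁ h₂,
    (Submodule.quotientProdEquiv _ _).length_eq, Module.length_prod]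

/-! ### Signed permutations -/

section Signed

/-- The pair `(j, u)` stands for the vector `u e_j`, and the matrices permute these vectors. As `2 ≠
0`, an entry determines its sign, so `s` is well defined and a cocycle. -/
theorem exists_signed_mulAction {D R : Type*} [Group D] [CommRing R] {n : ℕ}
    (h2 : (2 : R) ≠ 0) (τ : D →* GL (Fin n) R)
    (hτ : ∀ g, IsSignedPermMatrix (τ g : Matrix (Fin n) (Fin n) R)) :
    ∃ (_ : MulAction D (Fin n)) (_ : MulAction D (Fin n × ℤˣ)) (s : D → Fin n → ℤˣ),
      (∀ (g : D) (x : Fin n × ℤˣ), g • x = (g • x.1, s g x.1 * x.2)) ∧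
      ∀ g i j, (τ g : Matrix (Fin n) (Fin n) R) i j = if i = g • j then ((s g j : ℤ) : R) else 0 := by
  have h10 : (1 : R) ≠ 0 := fun h => h2 (by rw [← one_add_one_eq_two, h, add_zero])
  have h11 : (1 : R) ≠ -1 := fun h => h2 (by
    rw [← one_add_one_eq_two]; nth_rewrite 1 [h]; exact neg_add_cancel 1)
  have hu : ∀ u : ℤˣ, ((u : ℤ) : R) ≠ 0 := by
    intro u
    rcases Int.units_eq_one_or u with rfl | rfl <;> simpa using h10
  have huinj : ∀ u v : ℤˣ, ((u : ℤ) : R) = ((v : ℤ) : R) → u = v := by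
    intro u v
    rcases Int.units_eq_one_or u with rfl | rfl <;> rcases Int.units_eq_one_or v with rfl | rfl <;>
      simp [h11, h11.symm]
  have hex : ∀ g j, ∃ i, ∃ u : ℤˣ, ∀ k,
      (τ g : Matrix (Fin n) (Fin n) R) k j = if k = i then ((u : ℤ) : R) else 0 := by
    intro g j
    obtain ⟨i, hi, hiu⟩ := (hτ g).2.1 j
    have hz : ∀ k, k ≠ i → (τ g : Matrix (Fin n) (Fin n) R) k j = 0 := fun k hk =>
      not_not.mp fun h => hk (hiu k h)
    rcases (hτ g).2.2 i j hi with h | h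
    · refine ⟨i, 1, fun k => ?_⟩
      split_ifs with hk
      · simp [hk, h]
      · exact hz k hk
    · refine ⟨i, -1, fun k => ?_⟩
      split_ifs with hk
      · simp [hk, h]
      · exact hz k hk
  choose p s hps using hex
  have huniq : ∀ g j i (u : ℤˣ), (τ g : Matrix (Fin n) (Fin n) R) i j = ((u : ℤ) : R) →
      p g j = i ∧ s g j = u := by
    intro g j i u h
    rw [hps] at h
    split_ifs at h with hi
    · exact ⟨hi.symm, huinj _ _ h⟩
    · exact absurd h.symm (hu u)
  have hone : ∀ j, p 1 j = j ∧ s 1 j = 1 := fun j => huniq 1 j j 1 (by simp)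
  have hmul : ∀ g h j, p (g * h) j = p g (p h j) ∧ s (g * h) j = s g (p h j) * s h j := by
    intro g h j
    refine huniq _ _ _ _ ?_
    rw [map_mul, Units.val_mul, Matrix.mul_apply, Finset.sum_eq_single (p h j)]
    · rw [hps, hps, if_pos rfl, if_pos rfl]
      push_cast
      rfl
    · intro k _ hk
      rw [hps h, if_neg hk, mul_zero]
    · simp
  exact ⟨
    { smul := p
      one_smul := fun j => (hone j).1
      mul_smul := fun g h j => (hmul g h j).1 },
    { smul := fun g x => (p g x.1, s g x.1 * x.2)
      one_smul := fun x => Prod.ext (hone x.1).1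
        (by change s 1 x.1 * x.2 = x.2; rw [(hone x.1).2, one_mul])
      mul_smul := fun g h x => Prod.ext (hmul g h x.1).1
        (by change s (g * h) x.1 * x.2 = s g (p h x.1) * (s h x.1 * x.2)
            rw [(hmul g h x.1).2, mul_assoc]) },
    s, fun _ _ => rfl, fun g i j => hps g j i⟩

/-- Sums and differences of the values at `(i, 1)` and `(i, -1)`. -/
def sumDiffEquiv (ι A : Type*) [CommRing A] [Invertible (2 : A)] :
    (ι × ℤˣ → A) ≃ₗ[A] (ι → A) × (ι → A) where
  toFun φ := (fun i => φ (i, 1) + φ (i, -1), fun i => φ (i, 1) - φ (i, -1))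
  map_add' φ ψ := by
    ext <;> simp only [Pi.add_apply, Prod.fst_add, Prod.snd_add] <;> ring
  map_smul' c φ := by
    ext <;> simp [mul_add, mul_sub]
  invFun ab x := ⅟2 * (ab.1 x.1 + ((x.2 : ℤ) : A) * ab.2 x.1)
  left_inv φ := by
    funext ⟨i, u⟩
    rcases Int.units_eq_one_or u with rfl | rfl
    · have : ⅟(2 : A) * (2 * φ (i, 1)) = φ (i, 1) := invOf_mul_cancel_left _ _
      simp only [Units.val_one, Int.cast_one]
      linear_combination this
    · have : ⅟(2 : A) * (2 * φ (i, -1)) = φ (i, -1) := invOf_mul_cancel_left _ _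
      simp only [Units.val_neg, Units.val_one, Int.cast_neg, Int.cast_one]
      linear_combination this
  right_inv ab := by
    have h : ∀ x : A, ⅟(2 : A) * (2 * x) = x := fun x => invOf_mul_cancel_left _ _
    ext i
    · simp only [Units.val_neg, Units.val_one, Int.cast_neg, Int.cast_one]
      linear_combination h (ab.1 i)
    · simp only [Units.val_neg, Units.val_one, Int.cast_neg, Int.cast_one]
      linear_combination h (ab.2 i)

/-- The even part transforms by the permutation and the odd part picks up the sign. With `act` only
additive, the statement serves both the Galois action on `A` and the identity of `K`. -/
theorem signed_equivariant_iff {R A : Type*} [CommRing R] [CommRing A] [Algebra R A]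
    [Invertible (2 : A)] {n : ℕ} (act : A →+ A) (p : Fin n → Fin n) (s : Fin n → ℤˣ)
    (M : Matrix (Fin n) (Fin n) R)
    (hM : ∀ i j, M i j = if i = p j then ((s j : ℤ) : R) else 0) (φ : Fin n × ℤˣ → A) :
    (∀ x : Fin n × ℤˣ, φ (p x.1, s x.1 * x.2) = act (φ x)) ↔
      (∀ j, (sumDiffEquiv (Fin n) A φ).1 (p j) = act ((sumDiffEquiv (Fin n) A φ).1 j)) ∧
      ∀ j, ∑ i, M i j • (sumDiffEquiv (Fin n) A φ).2 i = act ((sumDiffEquiv (Fin n) A φ).2 j) := by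
  have hinj : ∀ x y : A, 2 * x = 2 * y → x = y := fun x y h => by
    rw [← invOf_mul_cancel_left (2 : A) x, h, invOf_mul_cancel_left]
  have hsum : ∀ (j) (b : Fin n → A), ∑ i, M i j • b i = ((s j : ℤ) : A) * b (p j) := by
    intro j b
    rw [Finset.sum_eq_single (p j)]
    · rw [hM, if_pos rfl, Algebra.smul_def, map_intCast]
    · intro i _ hi
      rw [hM, if_neg hi, zero_smul]
    · simp
  simp only [hsum]
  simp only [sumDiffEquiv, LinearEquiv.coe_mk, LinearMap.coe_mk, AddHom.coe_mk, map_add, map_sub]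
  rw [← forall_and]
  constructor
  · intro h j
    have h1 := h (j, 1)
    have h2 := h (j, -1)
    rw [← h1, ← h2]
    rcases Int.units_eq_one_or (s j) with hs | hs <;> simp only [hs] <;>
      (constructor <;> simp <;> ring)
  · rintro h ⟨j, u⟩
    obtain ⟨h1, h2⟩ := h j
    apply hinj
    rcases Int.units_eq_one_or (s j) with hs | hs <;>
      rcases Int.units_eq_one_or u with rfl | rfl <;>
      simp only [hs] at h2 ⊢ <;> simp at h2 ⊢ <;>
      first | linear_combination h1 + h2 | linear_combination h1 - h2

theorem IsSignedPermMatrix.inv_apply {D R : Type*} [Group D] [CommRing R] {n : ℕ}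
    {τ : D →* GL (Fin n) R} {g : D} (hg : IsSignedPermMatrix (τ g : Matrix (Fin n) (Fin n) R))
    (i j : Fin n) :
    (τ g⁻¹ : Matrix (Fin n) (Fin n) R) i j = (τ g : Matrix (Fin n) (Fin n) R) j i := by
  rw [← Matrix.transpose_apply (τ g : Matrix (Fin n) (Fin n) R), map_inv,
    ← Matrix.mul_one ((τ g)⁻¹ : GL (Fin n) R).val, ← hg.mul_transpose, ← Matrix.mul_assoc,
    Units.inv_mul, Matrix.one_mul]

/-- Fixed vectors are defined with the matrix, equivariant maps with its transpose. Signed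
permutation matrices are orthogonal, so passing to inverses in `H` exchanges the two conditions. -/
theorem mem_fixedVectors_iff {K D : Type*} [Field K] [ValuativeRel K] [Group D] {n : ℕ}
    {τ : D →* GL (Fin n) 𝒪[K]}
    (hτ : ∀ g, IsSignedPermMatrix (τ g : Matrix (Fin n) (Fin n) 𝒪[K])) (H : Subgroup D)
    (v : Fin n → K) : v ∈ fixedVectors τ H ↔
      ∀ g ∈ H, ∀ j, ∑ i, (τ g : Matrix (Fin n) (Fin n) 𝒪[K]) i j • v i = v j := by
  have key : ∀ g : D, ((τ g⁻¹ : Matrix (Fin n) (Fin n) 𝒪[K]).map (algebraMap 𝒪[K] K)).mulVec v = v ↔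
      ∀ j, ∑ i, (τ g : Matrix (Fin n) (Fin n) 𝒪[K]) i j • v i = v j := by
    intro g
    rw [funext_iff]
    refine forall_congr' fun j => ?_
    simp only [Matrix.mulVec, dotProduct, Matrix.map_apply, (hτ g).inv_apply, Algebra.smul_def]
  constructor
  · exact fun h g hg => (key g).mp (h _ (inv_mem hg))
  · intro h g hg
    have := (key g⁻¹).mpr (h _ (inv_mem hg))
    rwa [inv_inv] at this

section Additivity

variable {D : Type*} [Group D] {n : ℕ} [MulAction D (Fin n)] [MulAction D (Fin n × ℤˣ)]
  {s : D → Fin n → ℤˣ} (hs : ∀ (g : D) (x : Fin n × ℤˣ), g • x = (g • x.1, s g x.1 * x.2))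

include hs in
theorem permLength_signed {R A : Type*} [CommRing R] [CommRing A] [Algebra R A]
    [MulSemiringAction D A] [SMulCommClass D R A] (h2 : IsUnit (2 : A)) (τ : D →* GL (Fin n) R)
    (hτ : ∀ g i j, (τ g : Matrix (Fin n) (Fin n) R) i j =
      if i = g • j then ((s g j : ℤ) : R) else 0) :
    permLength D A (Fin n × ℤˣ) = permLength D A (Fin n) +
      Module.length A ((Fin n → A) ⧸ Submodule.span A
        (tuningSubmodule (MulSemiringAction.toAlgHom R A) τ : Set (Fin n → A))) := by
  have := h2.invertible
  refine Module.length_quotient_span_prod (sumDiffEquiv (Fin n) A) (by simp [equivariantMaps])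
    (Submodule.zero_mem _) fun φ => ?_
  have h := fun g => signed_equivariant_iff (MulSemiringAction.toAlgHom R A g : A →+ A) (g • ·)
    (s g) _ (hτ g) φ
  simp only [← hs] at h
  exact (forall_congr' h).trans forall_and

include hs in
theorem codim_permFixed_signed {K : Type*} [Field K] [ValuativeRel K] (h2 : (2 : K) ≠ 0)
    (τ : D →* GL (Fin n) 𝒪[K])
    (hsigned : ∀ g, IsSignedPermMatrix (τ g : Matrix (Fin n) (Fin n) 𝒪[K]))
    (hτ : ∀ g i j, (τ g : Matrix (Fin n) (Fin n) 𝒪[K]) i j =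
      if i = g • j then ((s g j : ℤ) : 𝒪[K]) else 0) (H : Subgroup D) :
    Module.finrank K ((Fin n × ℤˣ → K) ⧸ permFixed K H (Fin n × ℤˣ)) =
      Module.finrank K ((Fin n → K) ⧸ permFixed K H (Fin n)) +
        Module.finrank K ((Fin n → K) ⧸ fixedVectors τ H) := by
  have := invertibleOfNonzero h2
  have h : ∀ φ, φ ∈ permFixed K H (Fin n × ℤˣ) ↔
      sumDiffEquiv (Fin n) K φ ∈ (permFixed K H (Fin n)).prod (fixedVectors τ H) := by
    intro φ
    rw [Submodule.mem_prod, mem_fixedVectors_iff hsigned]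
    have h := fun g => signed_equivariant_iff (AddMonoidHom.id K) (g • ·) (s g) _ (hτ g) φ
    simp only [← hs] at h
    exact (forall₂_congr fun g _ => h g).trans forall₂_and
  rw [(Submodule.Quotient.equiv _ ((permFixed K H (Fin n)).prod (fixedVectors τ H))
    (sumDiffEquiv (Fin n) K) ?_).finrank_eq, (Submodule.quotientProdEquiv _ _).finrank_eq,
    Module.finrank_prod]
  ext x
  rw [Submodule.mem_map]
  constructor
  · rintro ⟨φ, hφ, rfl⟩
    exact (h φ).mp hφ
  · intro hx
    refine ⟨(sumDiffEquiv (Fin n) K).symm x, (h _).mpr ?_, ?_⟩ <;> simp [hx]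

end Additivity

/-- Both sides are additive for `Fin n × ℤˣ`, viewed as `Fin n` plus `τ`; subtracting the identity
for `Fin n`, whose left side is finite, leaves the one for `τ`. -/
theorem sum_card_mul_codim_fixedVectors {K D A : Type*} [Field K] [ValuativeRel K]
    [Group D] [Finite D] [CommRing A] [IsDomain A] [IsDiscreteValuationRing A] [Algebra 𝒪[K] A]
    [IsPrincipalIdealRing 𝒪[K]] [FaithfulSMul 𝒪[K] A] [MulSemiringAction D A]
    [IsGaloisGroup D 𝒪[K] A] [SMulCommClass D 𝒪[K] A]
    (hβ : ∃ β : A, Algebra.adjoin 𝒪[K] {β} = ⊤) (h2 : IsUnit (2 : 𝒪[K])) {n : ℕ}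
    (τ : D →* GL (Fin n) 𝒪[K])
    (hτ : ∀ g, IsSignedPermMatrix (τ g : Matrix (Fin n) (Fin n) 𝒪[K])) :
    ∃ N : ℕ, (∀ k ≥ N, ramificationFiltration D A k = ⊥) ∧
      ((∑ k ∈ Finset.range N, Nat.card (ramificationFiltration D A k) *
        Module.finrank K ((Fin n → K) ⧸ fixedVectors τ (ramificationFiltration D A k)) : ℕ) : ℕ∞) =
      2 * Module.length A ((Fin n → A) ⧸ Submodule.span A
        (tuningSubmodule (MulSemiringAction.toAlgHom 𝒪[K] A) τ : Set (Fin n → A))) := by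
  obtain ⟨_, _, s, hs, hM⟩ := exists_signed_mulAction h2.ne_zero τ hτ
  obtain ⟨N, hN, h⟩ := sum_card_mul_codim_permFixed (D := D) (R := 𝒪[K]) (A := A) K hβ
  refine ⟨N, hN, ?_⟩
  have h2A : IsUnit (2 : A) := map_ofNat (algebraMap 𝒪[K] A) 2 ▸ h2.map (algebraMap 𝒪[K] A)
  have h2K : (2 : K) ≠ 0 := map_ofNat (algebraMap 𝒪[K] K) 2 ▸ (h2.map (algebraMap 𝒪[K] K)).ne_zero
  have hX := h (Fin n × ℤˣ)
  have hn := h (Fin n)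
  rw [permLength_signed (A := A) hs h2A τ hM, mul_add, ← hn] at hX
  simp only [codim_permFixed_signed hs h2K τ hτ hM, mul_add, Finset.sum_add_distrib] at hX
  rw [Nat.cast_add] at hX
  exact WithTop.add_left_cancel (ENat.natCast_ne_top _) hX

end Signed

/-! ### Tuning lengths of torsors -/

section Torsor

variable {O B A Γ D m : Type*} [CommRing O] [CommRing B] [Algebra O B] [CommRing A] [Algebra O A]
  [Group Γ] [Group D] [Fintype m] [DecidableEq m] [MulSemiringAction D A] [SMulCommClass D O A]

omit [DecidableEq m] in
theorem Matrix.sum_smul_sum_smul (M N : Matrix m m O) (w : m → A) (j : m) :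
    ∑ i, N i j • ∑ k, M k i • w k = ∑ k, (M * N) k j • w k := by
  simp only [Finset.smul_sum, Matrix.mul_apply, Finset.sum_smul, smul_smul]
  rw [Finset.sum_comm]
  simp only [mul_comm]

theorem sum_inv_smul_sum_smul (τ : Γ →* GL m O) (x : Γ) (w : m → A) (j : m) :
    ∑ i, (τ x⁻¹ : Matrix m m O) i j • ∑ k, (τ x : Matrix m m O) k i • w k = w j := by
  rw [Matrix.sum_smul_sum_smul, ← Units.val_mul, ← map_mul, mul_inv_cancel, map_one]
  simp [Matrix.one_apply, ite_smul]

/-- The integers of the induced algebra `Ind_D^Γ A`, described through their values at the points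
of the torsor. -/
structure IsInducedAlgebra (act : Γ → B →ₐ[O] B) (j : D →* Γ) (ev : Γ → B →ₐ[O] A) : Prop where
  ev_act : ∀ γ x f, ev x (act γ f) = ev (x * γ) f
  ev_mul : ∀ d x f, ev (j d * x) f = d • ev x f
  exists_eq : ∀ F : Γ → A, (∀ d x, F (j d * x) = d • F x) → ∃ f, ∀ x, ev x f = F x
  ext : ∀ f f', (∀ x, ev x f = ev x f') → f = f'

namespace IsInducedAlgebra

variable {act : Γ → B →ₐ[O] B} {j : D →* Γ} {ev : Γ → B →ₐ[O] A}

theorem ev_one_mem (h : IsInducedAlgebra act j ev) {τ : Γ →* GL m O} {φ : m → B}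
    (hφ : φ ∈ tuningSubmodule act τ) :
    (fun i => ev 1 (φ i)) ∈ tuningSubmodule (MulSemiringAction.toAlgHom O A) (τ.comp j) := by
  intro d k
  have h1 := congrArg (ev 1) (hφ (j d) k)
  rw [map_sum, h.ev_act, one_mul, ← mul_one (j d), h.ev_mul, mul_one] at h1
  simp only [map_smul] at h1
  exact h1

/-- Equivariance forces the value at `x` to be obtained from the value at `1` through `τ x`; the
equivariance of `v` makes this formula a legitimate function on the torsor. -/
theorem exists_mem_tuningSubmodule (h : IsInducedAlgebra act j ev) {τ : Γ →* GL m O} {v : m → A}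
    (hv : v ∈ tuningSubmodule (MulSemiringAction.toAlgHom O A) (τ.comp j)) :
    ∃ φ ∈ tuningSubmodule act τ, ∀ i, ev 1 (φ i) = v i := by
  have hF : ∀ i, ∃ f, ∀ x, ev x f = ∑ k, (τ x : Matrix m m O) k i • v k := by
    refine fun i => h.exists_eq _ fun d x => ?_
    rw [map_mul, Units.val_mul, ← Matrix.sum_smul_sum_smul, Finset.smul_sum]
    refine Finset.sum_congr rfl fun k _ => ?_
    rw [smul_comm d]
    exact congrArg _ (hv d k)
  choose φ hφ using hF
  refine ⟨φ, fun γ k => h.ext _ _ fun x => ?_, fun i => ?_⟩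
  · simp only [map_sum, map_smul, h.ev_act, hφ, Matrix.sum_smul_sum_smul, map_mul, Units.val_mul]
  · simp [hφ, Matrix.one_apply, ite_smul]

omit [SMulCommClass D O A] in
-- Each `x` is `j d * q.out` for a unique `d`, as `j` is injective, so values at coset
-- representatives can be prescribed freely.
theorem exists_eq_on_transversal (h : IsInducedAlgebra act j ev) (hj : Function.Injective j)
    (a : Quotient (QuotientGroup.rightRel j.range) → A) : ∃ f, ∀ q, ev q.out f = a q := by
  have hd : ∀ x : Γ, ∃ d : D, j d *
      (Quotient.mk (QuotientGroup.rightRel j.range) x).out = x := by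
    intro x
    have h1 := Quotient.mk_out (s := QuotientGroup.rightRel j.range) x
    rw [QuotientGroup.rightRel_apply] at h1
    obtain ⟨d, hd⟩ := h1
    exact ⟨d, by rw [hd, inv_mul_cancel_right]⟩
  choose d hd using hd
  have hmk : ∀ e x, Quotient.mk (QuotientGroup.rightRel j.range) (j e * x) =
      Quotient.mk (QuotientGroup.rightRel j.range) x := by
    intro e x
    rw [Quotient.eq, QuotientGroup.rightRel_apply]
    exact ⟨e⁻¹, by simp⟩
  obtain ⟨f, hf⟩ := h.exists_eq
    (fun x => d x • a (Quotient.mk (QuotientGroup.rightRel j.range) x)) fun e x => by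
      rw [hmk, smul_smul]
      congr 1
      apply hj
      have h1 := hd (j e * x)
      rw [hmk] at h1
      have h2 := hd x
      rw [map_mul, ← mul_left_inj, h1, mul_assoc, h2]
  refine ⟨f, fun q => ?_⟩
  rw [hf, Quotient.out_eq]
  have h1 : d q.out = 1 := by
    apply hj
    have := hd q.out
    rw [Quotient.out_eq] at this
    rw [map_one]
    exact mul_eq_right.mp this
  rw [h1, one_smul]

omit [SMulCommClass D O A] in
theorem ext_of_transversal (h : IsInducedAlgebra act j ev) {f f' : B}
    (hf : ∀ q : Quotient (QuotientGroup.rightRel j.range), ev q.out f = ev q.out f') : f = f' := by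
  refine h.ext _ _ fun x => ?_
  have h1 := Quotient.mk_out (s := QuotientGroup.rightRel j.range) x
  rw [QuotientGroup.rightRel_apply] at h1
  obtain ⟨d, hd⟩ := h1
  have h2 : x = j d * (Quotient.mk (QuotientGroup.rightRel j.range) x).out := by
    rw [hd, inv_mul_cancel_right]
  rw [h2, h.ev_mul, h.ev_mul, hf]

/-- Evaluation at representatives of the cosets, followed by the twist that makes equivariant
maps constant. -/
def twistedEval (ev : Γ → B →ₐ[O] A) (j : D →* Γ) (τ : Γ →* GL m O) :
    (m → B) →ₗ[O] (Quotient (QuotientGroup.rightRel j.range) → m → A) :=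
  LinearMap.pi fun q => LinearMap.pi fun k =>
    ∑ i, (τ q.out⁻¹ : Matrix m m O) i k • (ev q.out).toLinearMap ∘ₗ LinearMap.proj i

omit [SMulCommClass D O A] [MulSemiringAction D A] in
theorem twistedEval_apply (τ : Γ →* GL m O) (φ : m → B)
    (q : Quotient (QuotientGroup.rightRel j.range)) (k : m) : twistedEval ev j τ φ q k =
      ∑ i, (τ q.out⁻¹ : Matrix m m O) i k • ev q.out (φ i) := by
  simp [twistedEval]

omit [SMulCommClass D O A] [MulSemiringAction D A] in
theorem twistedEval_smul (τ : Γ →* GL m O) (f : B) (φ : m → B)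
    (q : Quotient (QuotientGroup.rightRel j.range)) :
    twistedEval ev j τ (f • φ) q = ev q.out f • twistedEval ev j τ φ q := by
  ext k
  simp only [twistedEval_apply, Pi.smul_apply, smul_eq_mul, map_mul, Finset.mul_sum,
    mul_smul_comm]

omit [SMulCommClass D O A] in
theorem twistedEval_of_mem (h : IsInducedAlgebra act j ev) {τ : Γ →* GL m O} {φ : m → B}
    (hφ : φ ∈ tuningSubmodule act τ) (q : Quotient (QuotientGroup.rightRel j.range)) :
    twistedEval ev j τ φ q = fun i => ev 1 (φ i) := by
  ext k
  have h1 := congrArg (ev q.out) (hφ q.out⁻¹ k)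
  rw [map_sum, h.ev_act, mul_inv_cancel] at h1
  rw [twistedEval_apply, ← h1]
  simp only [map_smul]

omit [SMulCommClass D O A] in
theorem twistedEval_injective (h : IsInducedAlgebra act j ev) (τ : Γ →* GL m O) :
    Function.Injective (twistedEval ev j τ) := by
  intro φ φ' hφ
  ext i
  refine h.ext_of_transversal fun q => ?_
  have h1 := fun ψ : m → B => sum_inv_smul_sum_smul τ q.out⁻¹ (fun k => ev q.out (ψ k)) i
  simp only [← twistedEval_apply] at h1
  rw [← h1 φ, hφ, h1 φ']

omit [SMulCommClass D O A] in
theorem twistedEval_surjective (h : IsInducedAlgebra act j ev) (hj : Function.Injective j)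
    (τ : Γ →* GL m O) : Function.Surjective (twistedEval ev j τ) := by
  intro w
  choose φ hφ using fun i => h.exists_eq_on_transversal hj
    (fun q => ∑ k, (τ q.out : Matrix m m O) k i • w q k)
  refine ⟨φ, ?_⟩
  ext q k
  simp only [twistedEval_apply, hφ, sum_inv_smul_sum_smul]

/-- After the twist an equivariant map has the same component at every coset. Multiplying by the
element of `B` that is `1` on one coset and `0` on the others isolates a component, so the span is a
full product of copies of the span over `A`. -/
theorem mem_span_tuningSubmodule_iff [Finite Γ] (h : IsInducedAlgebra act j ev)
    (hj : Function.Injective j) (τ : Γ →* GL m O) (φ : m → B) :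
    φ ∈ Submodule.span B (tuningSubmodule act τ : Set (m → B)) ↔
      ∀ q, twistedEval ev j τ φ q ∈ Submodule.span A
        (tuningSubmodule (MulSemiringAction.toAlgHom O A) (τ.comp j) : Set (m → A)) := by
  classical
  constructor
  · intro hφ q
    induction hφ using Submodule.span_induction with
    | mem x hx =>
      rw [h.twistedEval_of_mem hx]
      exact Submodule.subset_span (h.ev_one_mem hx)
    | zero => simp
    | add x y _ _ hx hy =>
      rw [map_add, Pi.add_apply]
      exact add_mem hx hy
    | smul f x _ hx =>
      rw [twistedEval_smul]
      exact Submodule.smul_mem _ _ hx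
  · intro hφ
    have key : ∀ (q) (w : m → A), w ∈ Submodule.span A
        (tuningSubmodule (MulSemiringAction.toAlgHom O A) (τ.comp j) : Set (m → A)) →
        ∃ ψ ∈ Submodule.span B (tuningSubmodule act τ : Set (m → B)),
          twistedEval ev j τ ψ = Pi.single q w := by
      intro q w hw
      induction hw using Submodule.span_induction with
      | mem v hv =>
        obtain ⟨ψ, hψ, hψv⟩ := h.exists_mem_tuningSubmodule hv
        obtain ⟨e, he⟩ := h.exists_eq_on_transversal hj (Pi.single q 1)
        refine ⟨e • ψ, Submodule.smul_mem _ _ (Submodule.subset_span hψ), ?_⟩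
        ext q' i
        rw [twistedEval_smul, h.twistedEval_of_mem hψ, he]
        rcases eq_or_ne q' q with rfl | hq
        · simp [hψv]
        · simp [hq]
      | zero => exact ⟨0, zero_mem _, by simp⟩
      | add x y _ _ hx hy =>
        obtain ⟨a, ha, ha'⟩ := hx
        obtain ⟨b, hb, hb'⟩ := hy
        exact ⟨a + b, add_mem ha hb, by rw [map_add, ha', hb', Pi.single_add]⟩
      | smul c x _ hx =>
        obtain ⟨a, ha, ha'⟩ := hx
        obtain ⟨e, he⟩ := h.exists_eq_on_transversal hj fun _ => c
        refine ⟨e • a, Submodule.smul_mem _ _ ha, ?_⟩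
        ext q' i
        rw [twistedEval_smul, ha', he]
        rcases eq_or_ne q' q with rfl | hq
        · simp
        · simp [hq]
    have := Fintype.ofFinite (Quotient (QuotientGroup.rightRel j.range))
    choose ψ hψ hψ' using fun q => key q _ (hφ q)
    have h1 : φ = ∑ q, ψ q := by
      apply h.twistedEval_injective τ
      rw [map_sum]
      simp only [hψ']
      exact (Finset.univ_sum_single _).symm
    rw [h1]
    exact Submodule.sum_mem _ fun q _ => hψ q

/-- The quotient is a product of copies of the quotient over `A`, indexed by the `|Γ| / |D|` cosets.
-/
theorem tuningLength_mul_card [Finite Γ] (h : IsInducedAlgebra act j ev)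
    (hj : Function.Injective j) (τ : Γ →* GL m O) :
    tuningLength act τ * Nat.card D = Nat.card Γ *
      tuningLength (MulSemiringAction.toAlgHom O A) (τ.comp j) := by
  let S := Submodule.span A
    (tuningSubmodule (MulSemiringAction.toAlgHom O A) (τ.comp j) : Set (m → A))
  let Q := Quotient (QuotientGroup.rightRel j.range)
  let f : (m → B) →ₗ[O] (Q → (m → A) ⧸ S) :=
    (LinearMap.pi fun q => (S.mkQ.restrictScalars O) ∘ₗ LinearMap.proj q) ∘ₗ twistedEval ev j τ
  have hf : Function.Surjective f := by
    intro w
    choose v hv using fun q => S.mkQ_surjective (w q)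
    obtain ⟨φ, hφ⟩ := h.twistedEval_surjective hj τ v
    refine ⟨φ, ?_⟩
    ext1 q
    simp [f, hφ, ← hv]
  have hker : LinearMap.ker f = (Submodule.span B
      (tuningSubmodule act τ : Set (m → B))).restrictScalars O := by
    ext φ
    rw [LinearMap.mem_ker, Submodule.restrictScalars_mem, h.mem_span_tuningSubmodule_iff hj,
      funext_iff]
    refine forall_congr' fun q => ?_
    exact Submodule.Quotient.mk_eq_zero S
  have hcard : Nat.card Γ = Nat.card Q * Nat.card D := by
    rw [Subgroup.card_eq_card_quotient_mul_card_subgroup j.range,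
      Nat.card_congr (QuotientGroup.quotientRightRelEquivQuotientLeftRel j.range).symm,
      Nat.card_congr (MonoidHom.ofInjective hj).toEquiv]
  have h1 : tuningLength act τ = Nat.card Q * Module.length O ((m → A) ⧸ S) := by
    rw [← ENat.card_eq_coe_natCard, ← Module.length_pi,
      ← (LinearMap.quotKerEquivOfSurjective f hf).length_eq, hker]
    rfl
  rw [h1, hcard, Nat.cast_mul]
  change _ = _ * Module.length O ((m → A) ⧸ S)
  ring

end IsInducedAlgebra

end Torsor

/-! ### Direct sums -/

theorem tuningLength_directSumRep {O A Γ m m' : Type*} [CommRing O] [CommRing A] [Algebra O A]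
    [Group Γ] [Fintype m] [DecidableEq m] [Fintype m'] [DecidableEq m'] (act : Γ → A →ₐ[O] A)
    (τ : Γ →* GL m O) (τ' : Γ →* GL m' O) : tuningLength act (directSumRep τ τ') =
      tuningLength act τ + tuningLength act τ' := by
  have h : ∀ φ, φ ∈ tuningSubmodule act (directSumRep τ τ') ↔
      (LinearEquiv.sumArrowLequivProdArrow m m' A A φ).1 ∈ tuningSubmodule act τ ∧
      (LinearEquiv.sumArrowLequivProdArrow m m' A A φ).2 ∈ tuningSubmodule act τ' := by
    intro φ
    have h1 : φ ∈ tuningSubmodule act (directSumRep τ τ') ↔ ∀ γ k,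
      ∑ i, (Matrix.fromBlocks (τ γ : Matrix m m O) 0 0 (τ' γ : Matrix m' m' O) :
        Matrix (m ⊕ m') (m ⊕ m') O) i k • φ i =
        act γ (φ k) := Iff.rfl
    refine h1.trans (Iff.trans (forall_congr' fun γ => ?_) forall_and)
    simp [Sum.forall]
  let e := LinearEquiv.sumArrowLequivProdArrow m m' A A
  have he := Submodule.map_span_eq_of_forall_mem_iff (S' := (tuningSubmodule act τ : Set _) ×ˢ
    (tuningSubmodule act τ' : Set _)) e h
  rw [Submodule.span_prod_eq _ (zero_mem _) (zero_mem _)] at he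
  have h2 := ((Submodule.Quotient.equiv _ _ e he).trans
    (Submodule.quotientProdEquiv _ _)).restrictScalars O
  exact h2.length_eq.trans (Module.length_prod _ _ _)

theorem IsIntegral.of_forall_apply {R S X : Type*} [Finite X] [CommRing R] [CommRing S]
    [Algebra R S] {f : X → S} (hf : ∀ x, IsIntegral R (f x)) : IsIntegral R f := by
  have := Fintype.ofFinite X
  choose p hp hpf using hf
  refine ⟨∏ x, p x, Polynomial.monic_prod_of_monic _ _ fun x _ => hp x, ?_⟩
  change Polynomial.aeval f (∏ x, p x) = 0
  ext x
  have h := Polynomial.aeval_algHom_apply (Pi.evalAlgHom R (fun _ : X => S) x) f (∏ x, p x)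
  have h' : Polynomial.aeval (f x) (p x) = 0 := hpf x
  change Polynomial.aeval (f x) (∏ x, p x) = Polynomial.aeval f (∏ x, p x) x at h
  rw [← h, map_prod, Finset.prod_eq_zero (Finset.mem_univ x) h', Pi.zero_apply]

/-- The integral closure of `𝒪_K` in an extension `L` of `K`. -/
abbrev integersOf (K L : Type*) [Field K] [ValuativeRel K] [Field L] [Algebra K L] :
    Subalgebra 𝒪[K] L :=
  integralClosure 𝒪[K] L

theorem integersOf_map_isIntegral {K L E : Type*} [Field K] [ValuativeRel K] [Field L] [Algebra K L]
    [Field E] [Algebra K E] (f : L →ₐ[K] E) (x : integersOf K L) : IsIntegral 𝒪[K] (f x) :=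
  x.2.map (f.restrictScalars 𝒪[K])

/-! ### The torsor algebra as an algebra induced from the splitting field -/

namespace GaloisHom

section Field

variable {K Γ : Type*} [Field K] [Group Γ] (ρ : GaloisHom K Γ)

theorem fixingSubgroup_splittingField : ρ.splittingField.fixingSubgroup = ρ.hom.ker :=
  InfiniteGalois.fixingSubgroup_fixedField
    (⟨ρ.hom.ker, ρ.isClosed_ker⟩ : ClosedSubgroup Gal(SeparableClosure K/K))

theorem isOpen_ker : IsOpen (ρ.hom.ker : Set Gal(SeparableClosure K/K)) := by
  let _ : TopologicalSpace Γ := ⊥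
  have : DiscreteTopology Γ := ⟨rfl⟩
  have h : IsOpen (ρ.hom ⁻¹' {1}) := (isOpen_discrete {1}).preimage ρ.continuous_hom
  exact h

instance finiteDimensional_splittingField : FiniteDimensional K ρ.splittingField := by
  rw [← InfiniteGalois.isOpen_iff_finite, fixingSubgroup_splittingField]
  exact ρ.isOpen_ker

theorem ker_restrictNormalHom_splittingField :
    (AlgEquiv.restrictNormalHom (F := K) (K₁ := SeparableClosure K) ρ.splittingField).ker =
      ρ.hom.ker := by
  rw [IntermediateField.restrictNormalHom_ker, fixingSubgroup_splittingField]

/-- The embedding of `Gal(L/K)` into `Γ` induced by `ρ`. -/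
def galHom : Gal(ρ.splittingField/K) →* Γ :=
  (AlgEquiv.restrictNormalHom ρ.splittingField).liftOfSurjective
    (AlgEquiv.restrictNormalHom_surjective (F := K) (SeparableClosure K))
    ⟨ρ.hom, ρ.ker_restrictNormalHom_splittingField.le⟩

theorem galHom_restrictNormalHom (g : Gal(SeparableClosure K/K)) :
    ρ.galHom (AlgEquiv.restrictNormalHom ρ.splittingField g) = ρ.hom g :=
  MonoidHom.liftOfRightInverse_comp_apply _ _ _ _ g

theorem galHom_comp_restrictNormalHom :
    ρ.galHom.comp (AlgEquiv.restrictNormalHom ρ.splittingField) = ρ.hom :=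
  MonoidHom.ext ρ.galHom_restrictNormalHom

theorem galHom_injective : Function.Injective ρ.galHom := by
  rw [injective_iff_map_eq_one]
  intro d hd
  obtain ⟨g, rfl⟩ := AlgEquiv.restrictNormalHom_surjective (F := K) (K₁ := ρ.splittingField)
    (SeparableClosure K) d
  rw [galHom_restrictNormalHom, ← MonoidHom.mem_ker,
    ← ker_restrictNormalHom_splittingField] at hd
  exact hd

theorem apply_mem_splittingField (f : torsorAlgebra ρ) (x : Γ) :
    f.1 x ∈ ρ.splittingField := by
  rintro ⟨g, hg⟩
  have h := f.2 g x
  rw [MonoidHom.mem_ker.mp hg, one_mul] at h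
  exact h.symm

/-- Evaluation of a function on the torsor, as a map to `L`. -/
def torsorEval (x : Γ) : torsorAlgebra ρ →ₐ[K] ρ.splittingField where
  toFun f := ⟨f.1 x, ρ.apply_mem_splittingField f x⟩
  map_one' := rfl
  map_mul' _ _ := rfl
  map_zero' := rfl
  map_add' _ _ := rfl
  commutes' _ := rfl

end Field

section Local

variable {K Γ : Type*} [Field K] [ValuativeRel K] [Group Γ] (ρ : GaloisHom K Γ)

theorem ramificationGroup_eq_map (i : ℕ) : ρ.ramificationGroup i =
    (lowerRamificationGroup K ρ.splittingField i).map ρ.galHom := by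
  rw [ramificationGroup]
  conv_lhs => rw [← ρ.galHom_comp_restrictNormalHom]
  rw [← Subgroup.map_map, Subgroup.map_comap_eq_self_of_surjective
    (AlgEquiv.restrictNormalHom_surjective (F := K) (SeparableClosure K))]

/-- Evaluation of an integral function on the torsor, as a map to the integers of `L`. -/
def torsorIntegersEval (x : Γ) :
    torsorIntegers ρ →ₐ[𝒪[K]] integersOf K ρ.splittingField :=
  ((ρ.torsorEval x).restrictScalars 𝒪[K]).mapIntegralClosure

theorem isInducedAlgebra_torsorIntegers [Finite Γ] :
    IsInducedAlgebra (torsorIntegersAction ρ) ρ.galHom ρ.torsorIntegersEval where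
  ev_act _ _ _ := rfl
  ev_mul d x f := by
    obtain ⟨g, rfl⟩ := AlgEquiv.restrictNormalHom_surjective (F := K) (K₁ := ρ.splittingField)
      (SeparableClosure K) d
    rw [galHom_restrictNormalHom]
    apply Subtype.ext
    apply Subtype.ext
    refine (f.1.2 g x).trans ?_
    exact (AlgEquiv.restrictNormalHom_apply ρ.splittingField g
      (ρ.torsorIntegersEval x f).1).symm
  exists_eq F hF := by
    let f : Γ → SeparableClosure K := fun x => ((F x : ρ.splittingField) : SeparableClosure K)
    have hf : f ∈ torsorAlgebra ρ := by
      intro g x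
      simp only [f, ← ρ.galHom_restrictNormalHom, hF]
      exact AlgEquiv.restrictNormalHom_apply ρ.splittingField g (F x).1
    have hint : IsIntegral 𝒪[K] (⟨f, hf⟩ : torsorAlgebra ρ) := by
      rw [← isIntegral_algHom_iff ((torsorAlgebra ρ).val.restrictScalars 𝒪[K])
        Subtype.val_injective]
      refine IsIntegral.of_forall_apply fun x => ?_
      exact integersOf_map_isIntegral ρ.splittingField.val (F x)
    exact ⟨⟨⟨f, hf⟩, hint⟩, fun x => rfl⟩
  ext f f' h := by
    apply Subtype.ext
    apply Subtype.ext
    funext x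
    exact congrArg (fun y : integersOf K ρ.splittingField =>
      ((y : ρ.splittingField) : SeparableClosure K)) (h x)

end Local

end GaloisHom

theorem fixedVectors_map {K Γ D m : Type*} [Field K] [ValuativeRel K] [Group Γ] [Group D]
    [Fintype m] [DecidableEq m] (τ : Γ →* GL m 𝒪[K]) (j : D →* Γ) (H : Subgroup D) :
    fixedVectors τ (H.map j) = fixedVectors (τ.comp j) H := by
  ext v
  constructor
  · exact fun h d hd => h _ ⟨d, hd, rfl⟩
  · rintro h _ ⟨d, hd, rfl⟩
    exact h d hd

theorem fixedVectors_bot {K Γ m : Type*} [Field K] [ValuativeRel K] [Group Γ]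
    [Fintype m] [DecidableEq m] (τ : Γ →* GL m 𝒪[K]) : fixedVectors τ ⊥ = ⊤ := by
  rw [eq_top_iff]
  rintro v - _ rfl
  simp

theorem Subgroup.relIndex_mul_card' {G : Type*} [Group G] {H H' : Subgroup G} (h : H ≤ H') :
    Nat.card H * H.relIndex H' = Nat.card H' := by
  simpa only [relIndex_bot_left] using relIndex_mul_relIndex ⊥ H H' bot_le h

/-! ### Comparison of the conductor with the tuning length -/

section Comparison

variable {K : Type*} [Field K] [ValuativeRel K] [TopologicalSpace K]
  [IsNonarchimedeanLocalField K]

theorem isUnit_two_of_ringChar_ne_two (hp : ringChar 𝓀[K] ≠ 2) : IsUnit (2 : 𝒪[K]) := by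
  have h : IsLocalRing.residue 𝒪[K] 2 ≠ 0 := by
    rw [map_ofNat]
    exact Ring.two_ne_zero hp
  exact (IsLocalRing.residue_ne_zero_iff_isUnit _).mp h

omit [TopologicalSpace K] [IsNonarchimedeanLocalField K] in
theorem lowerRamificationGroup_antitone (L : Type*) [Field L] [Algebra K L] :
    Antitone (lowerRamificationGroup K L) := fun _ _ hij _ hg x =>
  Ideal.pow_le_pow_right (Nat.succ_le_succ hij) (hg x)

theorem exists_sum_codim_eq_and_tuningLength_eq {L Γ B : Type*} [Field L] [Algebra K L]
    [FiniteDimensional K L] [IsGalois K L] [Group Γ] [Finite Γ] [CommRing B] [Algebra 𝒪[K] B]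
    {act : Γ → B →ₐ[𝒪[K]] B} {j : Gal(L/K) →* Γ} {ev : Γ → B →ₐ[𝒪[K]] integersOf K L}
    (hev : IsInducedAlgebra act j ev) (hj : Function.Injective j) (hp : ringChar 𝓀[K] ≠ 2) {n : ℕ}
    (τ : Γ →* GL (Fin n) 𝒪[K])
    (hτ : ∀ g, IsSignedPermMatrix (τ g : Matrix (Fin n) (Fin n) 𝒪[K])) :
    ∃ N ℓ t : ℕ, (∀ k ≥ N, lowerRamificationGroup K L k = ⊥) ∧
      ∑ k ∈ Finset.range N, Nat.card (lowerRamificationGroup K L k) * Module.finrank K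
        ((Fin n → K) ⧸ fixedVectors (τ.comp j) (lowerRamificationGroup K L k)) = 2 * ℓ ∧
      tuningLength act τ = t ∧ t * Nat.card (lowerRamificationGroup K L 0) = Nat.card Γ * ℓ := by
  have := isDiscreteValuationRing_integralClosure K L
  have := finite_integralClosure K L
  have := faithfulSMul_integralClosure K L
  have := isLocalHom_integralClosure K L
  have := isGaloisGroup_integralClosure K L
  obtain ⟨N, hN, h⟩ := sum_card_mul_codim_fixedVectors (A := integersOf K L)
    (exists_adjoin_eq_top_integralClosure K L) (isUnit_two_of_ringChar_ne_two hp)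
    (τ.comp j) fun g => hτ _
  have hram : ramificationFiltration Gal(L/K) (integersOf K L) = lowerRamificationGroup K L :=
    funext fun k => (lowerRamificationGroup_eq K L k).symm
  rw [hram] at h hN
  have hfin : Module.length (integersOf K L) ((Fin n → integersOf K L) ⧸
      Submodule.span (integersOf K L) (tuningSubmodule
        (MulSemiringAction.toAlgHom 𝒪[K] (integersOf K L)) (τ.comp j) :
          Set (Fin n → integersOf K L))) ≠ ⊤ := fun htop => by
    rw [htop, ENat.mul_top (by norm_num)] at h
    exact ENat.natCast_ne_top _ h
  obtain ⟨ℓ, hℓ⟩ := ENat.ne_top_iff_exists.mp hfin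
  rw [← hℓ] at h
  have hef := card_ramificationFiltration_zero_mul_finrank (D := Gal(L/K)) (R := 𝒪[K])
    (A := integersOf K L)
  rw [hram] at hef
  have hf : Module.finrank (IsLocalRing.ResidueField 𝒪[K])
      (IsLocalRing.ResidueField (integersOf K L)) ≠ 0 := Module.finrank_pos.ne'
  have ht := hev.tuningLength_mul_card hj τ
  -- The length over `𝒪[K]` is the residue degree times the length over the integers of `L`.
  rw [tuningLength.eq_def (MulSemiringAction.toAlgHom 𝒪[K] (integersOf K L)),
    IsLocalRing.length_restrictScalars 𝒪[K] (integersOf K L), ← hℓ, Module.length_eq_finrank,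
    ← Nat.cast_mul, ← Nat.cast_mul] at ht
  have htop : tuningLength act τ ≠ ⊤ := fun htop => by
    rw [htop, ENat.top_mul (by simp)] at ht
    exact ENat.natCast_ne_top _ ht.symm
  obtain ⟨t, htl⟩ := ENat.ne_top_iff_exists.mp htop
  refine ⟨N, ℓ, t, hN, by exact_mod_cast h, htl.symm, ?_⟩
  -- Substituting `|D| = e f` makes the residue degree a common factor, which cancels.
  rw [← htl, ← hef, ← Nat.cast_mul, Nat.cast_inj] at ht
  apply Nat.eq_of_mul_eq_mul_right (Nat.pos_of_ne_zero hf)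
  linarith

/-- The Artin conductor and the tuning length of a signed permutation representation; `e` is the
order of the inertia group. -/
theorem exists_artinConductor_eq {Γ : Type*} [Group Γ] [Finite Γ] (hp : ringChar 𝓀[K] ≠ 2) {n : ℕ}
    (τ : Γ →* GL (Fin n) 𝒪[K])
    (hτ : ∀ g, IsSignedPermMatrix (τ g : Matrix (Fin n) (Fin n) 𝒪[K])) (ρ : GaloisHom K Γ) :
    ∃ e ℓ t : ℕ, e ≠ 0 ∧ artinConductor τ ρ = (2 * ℓ : ℕ) / (e : ℝ≥0∞) ∧
      tuningLength (torsorIntegersAction ρ) τ = t ∧ t * e = Nat.card Γ * ℓ := by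
  obtain ⟨N, ℓ, t, hN, h, htl, ht⟩ := exists_sum_codim_eq_and_tuningLength_eq
    ρ.isInducedAlgebra_torsorIntegers ρ.galHom_injective hp τ hτ
  refine ⟨_, ℓ, t, Nat.card_pos.ne', ?_, htl, ht⟩
  -- The weight `1 / (H_0 : H_i)` is `|H_i| / |H_0|`, which turns the conductor into the weighted
  -- sum of codimensions divided by `e`.
  have hterm : ∀ i, (Module.finrank K ((Fin n → K) ⧸ fixedVectors τ (ρ.ramificationGroup i)) :
      ℝ≥0∞) / ((ρ.ramificationGroup i).relIndex (ρ.ramificationGroup 0) : ℝ≥0∞) =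
      (Nat.card (lowerRamificationGroup K ρ.splittingField i) * Module.finrank K ((Fin n → K) ⧸
        fixedVectors (τ.comp ρ.galHom) (lowerRamificationGroup K ρ.splittingField i)) : ℕ) /
          (Nat.card (lowerRamificationGroup K ρ.splittingField 0) : ℝ≥0∞) := by
    intro i
    rw [ρ.ramificationGroup_eq_map, ρ.ramificationGroup_eq_map, fixedVectors_map,
      Subgroup.relIndex_map_map_of_injective _ _ ρ.galHom_injective,
      ← Subgroup.relIndex_mul_card' (lowerRamificationGroup_antitone _ (Nat.zero_le i)),
      Nat.cast_mul, Nat.cast_mul, ENNReal.mul_div_mul_left _ _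
        (Nat.cast_ne_zero.mpr Nat.card_pos.ne') (ENNReal.natCast_ne_top _)]
  rw [artinConductor, tsum_eq_sum (s := Finset.range N)]
  · rw [← h, Nat.cast_sum, div_eq_mul_inv, Finset.sum_mul]
    simp only [← div_eq_mul_inv]
    exact Finset.sum_congr rfl fun i _ => hterm i
  · intro i hi
    rw [hterm, hN i (by simpa using hi), fixedVectors_bot]
    simp [Module.finrank_zero_of_subsingleton]

end Comparison

end

theorem mainTheorem11 {K : Type*} [Field K] [ValuativeRel K] [TopologicalSpace K]
    [IsNonarchimedeanLocalField K] (hp : ringChar 𝓀[K] ≠ 2) (n : ℕ) :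
    (∀ ρ : GaloisHom K (signedPermGroup n 𝒪[K]),
        artinConductor (signedPermGroup n 𝒪[K]).subtype ρ ≠ ∞) ∧
      artinConductor (signedPermGroup n 𝒪[K]).subtype =
        vFunction (directSumRep (signedPermGroup n 𝒪[K]).subtype
          (signedPermGroup n 𝒪[K]).subtype) := by
  have h := exists_artinConductor_eq hp (signedPermGroup n 𝒪[K]).subtype fun g => g.2
  constructor
  · intro ρ
    obtain ⟨e, ℓ, t, he, ha, -⟩ := h ρ
    rw [ha]
    exact ENNReal.div_ne_top (ENNReal.natCast_ne_top _) (Nat.cast_ne_zero.mpr he)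
  · funext ρ
    obtain ⟨e, ℓ, t, he, ha, htl, hte⟩ := h ρ
    have hcard : Nat.card (signedPermGroup n 𝒪[K]) ≠ 0 := Nat.card_pos.ne'
    rw [ha, vFunction, tuningLength_directSumRep, htl, ← Nat.cast_add, ENat.toENNReal_coe,
      ENNReal.div_eq_div_iff (Nat.cast_ne_zero.mpr hcard) (ENNReal.natCast_ne_top _)
        (Nat.cast_ne_zero.mpr he) (ENNReal.natCast_ne_top _), ← Nat.cast_mul, ← Nat.cast_mul]
    -- With denominators cleared, `2ℓ / e = (t + t) / |G|` is twice the relation `t e = |G| ℓ`.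
    congr 1
    linarith
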